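/- Write $\chi_S(x)=\prod_{j\in S}x_j$ for $S\subseteq[n]$ and $x\in\{\pm1\}^n$; the degree of $f:\{\pm1\}^n\to\mathbb R$ is the largest $|S|$ with $\hat f(S)=\mathbb E[f(x)\chi_S(x)]\neq0$, where $x$ is uniform in $\{\pm 1\}^n$. There is a constant $c>1$ and a learning algorithm (a single program for a random access machine with exact real arithmetic at unit cost) with thresholds $\tau(n,d,\varepsilon)>0$ such that the following holds for all integers $n\ge2$, $d\ge1$ and all real $\varepsilon>0$. 1. Given $n,d,\varepsilon$ and any samples $(X_1,y_1),\dots,(X_N,y_N)\in\{\pm1\}^n\times\mathbb R$, the algorithm runs in time polynomial in $n^d$ and $N+1$ and outputs, as a list of monomials with coefficients, the function $$g=\sum_{|S|\le d,\ |\alpha_S|\ge\tau(n,d,\varepsilon)}\alpha_S\,\chi_S,\qquad \alpha_S=\frac1N\sum_{i=1}^N y_i\,\chi_S(X_i)$$ (with $\alpha_S=0$ if $N=0$), that is, it estimates the Fourier coefficients and keeps the large ones. 2. For every $\delta\in(0,1)$ there is an integer $$N_0\le 2^{cd^2}\,\frac{n^{d-1}\max\{\log n,\log(1/\delta)\}}{\varepsilon^3}$$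 such that for every $N\ge N_0$ and every $f:\{\pm1\}^n\to[-1,1]$ of degree at most $d$: if $X_1,\dots,X_N$ are independent and uniform in $\{\pm1\}^n$ and $y_i=f(X_i)$, then with probability at least $1-\delta$ the output $g$ satisfies $\mathbb E|f(x)-g(x)|^2\le\varepsilon$ for uniform $x\in\{\pm 1\}^n$. In particular, for $1/n\le\delta<1$ one has $N_0\le 2^{cd^2}n^{d-1}\log(n)/\varepsilon^3$. -/

import Mathlib

open scoped BigOperators

/-! ### Functions on the discrete cube -/

namespace BooleanCube

/-- The discrete cube `{±1}^n`. -/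
abbrev Cube (n : ℕ) : Type := Fin n → ℤˣ

/-- The character `χ_S(x) = ∏_{j ∈ S} x_j`. -/
def chi {n : ℕ} (S : Finset (Fin n)) (x : Cube n) : ℝ := ∏ j ∈ S, ((x j : ℤ) : ℝ)

/-- The expectation of `F` at a uniformly random point of a finite type. -/
noncomputable def expect {Ω : Type} [Fintype Ω] (F : Ω → ℝ) : ℝ :=
  (∑ ω, F ω) / (Fintype.card Ω : ℝ)

/-- The probability of `A` under the uniform distribution on a finite type. For
`Ω = (Fin N → Cube n)` this is the law of `N` independent uniform points of the cube. -/
noncomputable def prob {Ω : Type} [Fintype Ω] (A : Set Ω) : ℝ :=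
  (A.ncard : ℝ) / (Fintype.card Ω : ℝ)

/-- The Fourier coefficient of `f` at `S`. -/
noncomputable def fourierCoeff {n : ℕ} (f : Cube n → ℝ) (S : Finset (Fin n)) : ℝ :=
  expect fun x => f x * chi S x

open Classical in
/-- The degree of `f`: the largest `|S|` with a nonzero Fourier coefficient (`0` if `f = 0`). -/
noncomputable def degree {n : ℕ} (f : Cube n → ℝ) : ℕ :=
  (Finset.univ.filter fun S : Finset (Fin n) => fourierCoeff f S ≠ 0).sup Finset.card

/-- The squared error `E |f(x) - g(x)|²` for a uniformly random `x`. -/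
noncomputable def sqError {n : ℕ} (f g : Cube n → ℝ) : ℝ :=
  expect fun x => |f x - g x| ^ 2

/-- The empirical estimate `(1/N) ∑_j y_j χ_S(X_j)` of the Fourier coefficient at `S`
(it is `0` when there are no samples). -/
noncomputable def empCoeff {n N : ℕ} (X : Fin N → Cube n) (y : Fin N → ℝ)
    (S : Finset (Fin n)) : ℝ :=
  (∑ j, y j * chi S (X j)) / (N : ℝ)

open Classical in
/-- The hypothesis that keeps the estimated coefficients of level at most `d` that are at least
`τ` in absolute value. -/
noncomputable def largeCoeffFunction {n N : ℕ} (d : ℕ) (τ : ℝ) (X : Fin N → Cube n)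
    (y : Fin N → ℝ) (x : Cube n) : ℝ :=
  ∑ S ∈ Finset.univ.filter
      (fun S : Finset (Fin n) => S.card ≤ d ∧ τ ≤ |empCoeff X y S|),
    empCoeff X y S * chi S x

end BooleanCube

/-! ### Random access machines over the reals

A program works on finitely many named, unbounded arrays of natural numbers and finitely many
named, unbounded arrays of reals. It may add and (truncatedly) subtract natural numbers, perform
exact field operations on reals, use natural numbers as array indices and as reals, and compare.
Natural numbers are not multiplied in one step, so their bit length stays below the running
time plus that of the input. -/

namespace RealRAM

/-- The memory: entry `i` of array `a` is `nat a i`, respectively `real a i`. -/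
structure State where
  nat : ℕ → ℕ → ℕ
  real : ℕ → ℕ → ℝ

/-- Expressions with natural number values. -/
inductive NExp : Type
  | lit (k : ℕ) : NExp
  | get (a : ℕ) (i : NExp) : NExp
  | add (e₁ e₂ : NExp) : NExp
  | sub (e₁ e₂ : NExp) : NExp

/-- Expressions with real values. -/
inductive RExp : Type
  | cast (e : NExp) : RExp
  | get (a : ℕ) (i : NExp) : RExp
  | add (e₁ e₂ : RExp) : RExp
  | sub (e₁ e₂ : RExp) : RExp
  | mul (e₁ e₂ : RExp) : RExp
  | div (e₁ e₂ : RExp) : RExp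

/-- Tests that a program may branch on. -/
inductive Test : Type
  | lt (e₁ e₂ : NExp) : Test
  | le (e₁ e₂ : RExp) : Test

/-- Programs. -/
inductive Prog : Type
  | setNat (a : ℕ) (i v : NExp) : Prog
  | setReal (a : ℕ) (i : NExp) (v : RExp) : Prog
  | seq (p q : Prog) : Prog
  | ite (b : Test) (p q : Prog) : Prog
  | loop (b : Test) (p : Prog) : Prog

/-- The value of an expression. -/
def NExp.eval (s : State) : NExp → ℕ
  | lit k => k
  | get a i => s.nat a (i.eval s)
  | add e₁ e₂ => e₁.eval s + e₂.eval s
  | sub e₁ e₂ => e₁.eval s - e₂.eval s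

/-- The number of operations in an expression. -/
def NExp.cost : NExp → ℕ
  | lit _ => 1
  | get _ i => i.cost + 1
  | add e₁ e₂ => e₁.cost + e₂.cost + 1
  | sub e₁ e₂ => e₁.cost + e₂.cost + 1

/-- The value of an expression (division by zero gives zero). -/
noncomputable def RExp.eval (s : State) : RExp → ℝ
  | cast e => (e.eval s : ℝ)
  | get a i => s.real a (i.eval s)
  | add e₁ e₂ => e₁.eval s + e₂.eval s
  | sub e₁ e₂ => e₁.eval s - e₂.eval s
  | mul e₁ e₂ => e₁.eval s * e₂.eval s
  | div e₁ e₂ => e₁.eval s / e₂.eval s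

/-- The number of operations in an expression. -/
def RExp.cost : RExp → ℕ
  | cast e => e.cost + 1
  | get _ i => i.cost + 1
  | add e₁ e₂ => e₁.cost + e₂.cost + 1
  | sub e₁ e₂ => e₁.cost + e₂.cost + 1
  | mul e₁ e₂ => e₁.cost + e₂.cost + 1
  | div e₁ e₂ => e₁.cost + e₂.cost + 1

/-- The truth of a test. -/
def Test.holds (s : State) : Test → Prop
  | lt e₁ e₂ => e₁.eval s < e₂.eval s
  | le e₁ e₂ => e₁.eval s ≤ e₂.eval s

/-- The number of operations in a test. -/
def Test.cost : Test → ℕ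
  | lt e₁ e₂ => e₁.cost + e₂.cost + 1
  | le e₁ e₂ => e₁.cost + e₂.cost + 1

/-- Overwrite one entry of an array of natural numbers. -/
def State.setNat (s : State) (a i v : ℕ) : State :=
  { s with nat := Function.update s.nat a (Function.update (s.nat a) i v) }

/-- Overwrite one entry of an array of reals. -/
def State.setReal (s : State) (a i : ℕ) (v : ℝ) : State :=
  { s with real := Function.update s.real a (Function.update (s.real a) i v) }

/-- `Exec p s s' t`: the program `p`, started in `s`, halts in `s'` after `t` steps. -/
inductive Exec : Prog → State → State → ℕ → Prop
  | setNat (a : ℕ) (i v : NExp) (s : State) :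
      Exec (.setNat a i v) s (s.setNat a (i.eval s) (v.eval s)) (i.cost + v.cost + 1)
  | setReal (a : ℕ) (i : NExp) (v : RExp) (s : State) :
      Exec (.setReal a i v) s (s.setReal a (i.eval s) (v.eval s)) (i.cost + v.cost + 1)
  | seq {p q : Prog} {s s' s'' : State} {t t' : ℕ} :
      Exec p s s' t → Exec q s' s'' t' → Exec (.seq p q) s s'' (t + t')
  | ite_true {b : Test} {p q : Prog} {s s' : State} {t : ℕ} :
      b.holds s → Exec p s s' t → Exec (.ite b p q) s s' (b.cost + t)
  | ite_false {b : Test} {p q : Prog} {s s' : State} {t : ℕ} :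
      ¬ b.holds s → Exec q s s' t → Exec (.ite b p q) s s' (b.cost + t)
  | loop_done {b : Test} {p : Prog} {s : State} :
      ¬ b.holds s → Exec (.loop b p) s s b.cost
  | loop_step {b : Test} {p : Prog} {s s' s'' : State} {t t' : ℕ} :
      b.holds s → Exec p s s' t → Exec (.loop b p) s' s'' t' →
      Exec (.loop b p) s s'' (b.cost + t + t')

/-- Execution is deterministic: a program has at most one outcome and one running time. -/
theorem Exec.unique {p : Prog} {s s₁ s₂ : State} {t₁ t₂ : ℕ}
    (h₁ : Exec p s s₁ t₁) (h₂ : Exec p s s₂ t₂) : s₁ = s₂ ∧ t₁ = t₂ := by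
  induction h₁ generalizing s₂ t₂ with
  | setNat => cases h₂; exact ⟨rfl, rfl⟩
  | setReal => cases h₂; exact ⟨rfl, rfl⟩
  | seq _ _ ih ih' =>
    cases h₂ with
    | seq g g' =>
      obtain ⟨rfl, rfl⟩ := ih g
      obtain ⟨rfl, rfl⟩ := ih' g'
      exact ⟨rfl, rfl⟩
  | ite_true hb _ ih =>
    cases h₂ with
    | ite_true _ g => obtain ⟨rfl, rfl⟩ := ih g; exact ⟨rfl, rfl⟩
    | ite_false hb' _ => exact absurd hb hb'
  | ite_false hb _ ih =>
    cases h₂ with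
    | ite_true hb' _ => exact absurd hb' hb
    | ite_false _ g => obtain ⟨rfl, rfl⟩ := ih g; exact ⟨rfl, rfl⟩
  | loop_done hb =>
    cases h₂ with
    | loop_done _ => exact ⟨rfl, rfl⟩
    | loop_step hb' _ _ => exact absurd hb' hb
  | loop_step hb _ _ ih ih' =>
    cases h₂ with
    | loop_done hb' => exact absurd hb hb'
    | loop_step _ g g' =>
      obtain ⟨rfl, rfl⟩ := ih g
      obtain ⟨rfl, rfl⟩ := ih' g'
      exact ⟨rfl, rfl⟩

end RealRAM

namespace BooleanCube

/-- The initial memory of a learner with parameters `n, d, ε` and samples `(X_j, y_j)`, `j < N`.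
Array `nat 0` holds `n, d, N`; `real 0` holds `ε`; `real 1` holds the values `y_j`; `real 2`
holds the points, coordinate `i` of `X_j` at index `j * n + i`. All other entries are zero. -/
noncomputable def learnerInput {n N : ℕ} (d : ℕ) (ε : ℝ) (X : Fin N → Cube n)
    (y : Fin N → ℝ) : RealRAM.State where
  nat := fun a i => if a = 0 then (if i = 0 then n else if i = 1 then d else if i = 2 then N else 0)
    else 0
  real := fun a i =>
    if a = 0 then (if i = 0 then ε else 0)
    else if a = 1 then (if h : i < N then y ⟨i, h⟩ else 0)
    else if a = 2 then
      (if h : i / n < N ∧ i % n < n then ((X ⟨i / n, h.1⟩ ⟨i % n, h.2⟩ : ℤ) : ℝ) else 0)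
    else 0

/-- The number `K` of terms of the output polynomial, found in `nat 1` at index `0`. -/
def outputLength (s : RealRAM.State) : ℕ := s.nat 1 0

/-- The function `x ↦ ∑_{k < K} a_k χ_{S_k}(x)` written in the memory `s`: `a_k` is entry `k` of
`real 3`, and `i ∈ S_k` when entry `k * n + i` of `nat 2` is nonzero. -/
noncomputable def outputFunction (n : ℕ) (s : RealRAM.State) (x : Cube n) : ℝ :=
  ∑ k ∈ Finset.range (outputLength s),
    s.real 3 k * chi (Finset.univ.filter fun i : Fin n => s.nat 2 (k * n + i) ≠ 0) x

/-- With parameters `n, d, ε` and samples `(X_j, y_j)`, the program `P` halts within `T` steps and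
writes down the function `g` as a list of at most `T` monomials with coefficients. -/
def LearnerOutputs {n N : ℕ} (P : RealRAM.Prog) (d : ℕ) (ε : ℝ) (X : Fin N → Cube n)
    (y : Fin N → ℝ) (T : ℕ) (g : Cube n → ℝ) : Prop :=
  ∃ (s : RealRAM.State) (t : ℕ), RealRAM.Exec P (learnerInput d ε X y) s t ∧ t ≤ T ∧
    outputLength s ≤ T ∧ outputFunction n s = g

end BooleanCube

/-! The heart of the proof is an `ℓ¹` bound on the Fourier spectrum: a function bounded by 1 of
degree at most `d` has `∑ |f̂(S)| ≤ C^d n^((d-1)/2)` (`sum_abs_fourierCoeff_le`). Charge each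
nonempty `S` to one of its elements `i`, so that `f̂(S)` becomes a coefficient of the derivative
`D_i f`. This has degree at most `d - 1`, hence at most `(n+1)^(d-1)` nonzero coefficients, and
Cauchy–Schwarz with Parseval bounds their sum by `(n+1)^((d-1)/2) ‖D_i f‖₂`. Hypercontractivity
replaces the `L²` norm by the `L¹` norm at the cost of a factor `C^d`. Finally `∑_i |D_i f(x)| ≤
2·5^d` at every point `x` (`sum_abs_deriv_le`), with no dependence on `n`: along a line inside the
solid cube the multilinear extension of `f` is a polynomial of degree at most `d` bounded by 1, and
its linear coefficient is bounded in terms of `d` alone.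

If all empirical coefficients of level at most `d` are `η`-accurate, then discarding those below
`2η` leaves a squared error of at most `3η ∑ |f̂(S)|` (`sqError_le_of_accurate`). Thus `η` of order
`ε / (C^d n^((d-1)/2))` suffices, and a Chernoff bound with a union bound over `(n+1)^d` sets gives
this accuracy from about `η⁻² log((n+1)^d / δ)` samples. This is of order `ε⁻²`, which is at most
`ε⁻³` when `ε ≤ 1`; for `ε > 1` the zero hypothesis is already good enough.

The algorithm is an explicit program that lists all sets of size at most `d`, computes their
empirical coefficients and replaces the small ones by zero. It compares squares, so no square root
is needed. Its correctness and running time (`learner_outputs`) follow from loop invariants with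
step counts. -/

namespace BooleanCube

/-! ### Expectations over finite types -/

section Expect

variable {Ω : Type} [Fintype Ω]

theorem expect_add (F G : Ω → ℝ) :
    expect (fun ω => F ω + G ω) = expect F + expect G := by
  simp [expect, Finset.sum_add_distrib, add_div]

theorem expect_sub (F G : Ω → ℝ) :
    expect (fun ω => F ω - G ω) = expect F - expect G := by
  simp [expect, Finset.sum_sub_distrib, sub_div]

theorem expect_neg (F : Ω → ℝ) : expect (fun ω => - F ω) = - expect F := by
  simp [expect, Finset.sum_neg_distrib, neg_div]

theorem expect_const_mul (a : ℝ) (F : Ω → ℝ) :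
    expect (fun ω => a * F ω) = a * expect F := by
  simp [expect, ← Finset.mul_sum, mul_div_assoc]

theorem expect_sum {ι : Type*} (s : Finset ι) (F : ι → Ω → ℝ) :
    expect (fun ω => ∑ i ∈ s, F i ω) = ∑ i ∈ s, expect (F i) := by
  simp only [expect, ← Finset.sum_div]
  rw [Finset.sum_comm]

theorem expect_const [Nonempty Ω] (a : ℝ) : expect (fun _ : Ω => a) = a := by
  simp [expect]

theorem expect_mono {F G : Ω → ℝ} (h : ∀ ω, F ω ≤ G ω) : expect F ≤ expect G := by
  unfold expect
  gcongr with ω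
  exact h ω

theorem expect_nonneg {F : Ω → ℝ} (h : ∀ ω, 0 ≤ F ω) : 0 ≤ expect F :=
  div_nonneg (Finset.sum_nonneg fun ω _ => h ω) (Nat.cast_nonneg _)

theorem abs_expect_le (F : Ω → ℝ) : |expect F| ≤ expect fun ω => |F ω| := by
  unfold expect
  rw [abs_div, Nat.abs_cast]
  gcongr
  exact Finset.abs_sum_le_sum_abs _ _

theorem expect_comp_involutive {φ : Ω → Ω} (hφ : Function.Involutive φ) (F : Ω → ℝ) :
    expect (fun ω => F (φ ω)) = expect F := by
  unfold expect
  congr 1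
  exact Equiv.sum_comp hφ.toPerm F

/-- The Cauchy–Schwarz inequality. -/
theorem sq_expect_mul_le (F G : Ω → ℝ) :
    (expect fun ω => F ω * G ω) ^ 2 ≤ (expect fun ω => F ω ^ 2) * expect fun ω => G ω ^ 2 := by
  unfold expect
  rw [div_pow, div_mul_div_comm, ← sq]
  gcongr
  exact Finset.sum_mul_sq_le_sq_mul_sq _ _ _

end Expect

/-! ### Characters -/

variable {n : ℕ}

@[simp] theorem chi_empty (x : Cube n) : chi ∅ x = 1 := by simp [chi]

theorem sign_mul_self (u : ℤˣ) : ((u : ℤ) : ℝ) * ((u : ℤ) : ℝ) = 1 := by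
  rcases Int.units_eq_one_or u with h | h <;> simp [h]

theorem abs_sign (u : ℤˣ) : |((u : ℤ) : ℝ)| = 1 := by
  rcases Int.units_eq_one_or u with h | h <;> simp [h]

theorem abs_chi (S : Finset (Fin n)) (x : Cube n) : |chi S x| = 1 := by
  simp [chi, Finset.abs_prod, abs_sign]

theorem chi_insert {S : Finset (Fin n)} {i : Fin n} (h : i ∉ S) (x : Cube n) :
    chi (insert i S) x = ((x i : ℤ) : ℝ) * chi S x := by
  simp [chi, Finset.prod_insert h]

theorem chi_mul_chi (S T : Finset (Fin n)) (x : Cube n) :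
    chi S x * chi T x = chi (symmDiff S T) x := by
  have h (U : Finset (Fin n)) :
      chi U x = ∏ j, if j ∈ U then ((x j : ℤ) : ℝ) else 1 := by
    simp [chi]
  rw [h, h, h, ← Finset.prod_mul_distrib]
  refine Finset.prod_congr rfl fun j _ => ?_
  by_cases h1 : j ∈ S <;> by_cases h2 : j ∈ T <;>
    simp [Finset.mem_symmDiff, h1, h2, sign_mul_self]

/-- Reverse the sign of one coordinate. -/
def flipCoord (i : Fin n) (x : Cube n) : Cube n := Function.update x i (- x i)

theorem flipCoord_involutive (i : Fin n) : Function.Involutive (flipCoord i) := by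
  intro x
  simp [flipCoord]

theorem chi_flipCoord_of_notMem {S : Finset (Fin n)} {i : Fin n} (h : i ∉ S) (x : Cube n) :
    chi S (flipCoord i x) = chi S x := by
  refine Finset.prod_congr rfl fun j hj => ?_
  have : j ≠ i := fun e => h (e ▸ hj)
  simp [flipCoord, this]

/-- An odd function of one coordinate has mean zero. -/
theorem expect_sign_mul {F : Cube n → ℝ} {i : Fin n} (hF : ∀ x, F (flipCoord i x) = F x) :
    expect (fun x : Cube n => ((x i : ℤ) : ℝ) * F x) = 0 := by
  have h := expect_comp_involutive (flipCoord_involutive i)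
    (fun x : Cube n => ((x i : ℤ) : ℝ) * F x)
  simp only [hF] at h
  have h2 : expect (fun x : Cube n => ((flipCoord i x i : ℤ) : ℝ) * F x)
      = - expect (fun x : Cube n => ((x i : ℤ) : ℝ) * F x) := by
    rw [← expect_neg]
    congr 1
    ext x
    simp [flipCoord]
  linarith

theorem expect_chi (S : Finset (Fin n)) : expect (chi S) = if S = ∅ then 1 else 0 := by
  split_ifs with h
  · subst h
    have : (chi (∅ : Finset (Fin n))) = fun _ => 1 := by ext; simp
    rw [this, expect_const]
  · obtain ⟨i, hi⟩ := Finset.nonempty_iff_ne_empty.2 h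
    have h1 : chi S = fun x => ((x i : ℤ) : ℝ) * chi (S.erase i) x := by
      ext x
      rw [← chi_insert (Finset.notMem_erase i S), Finset.insert_erase hi]
    rw [h1]
    exact expect_sign_mul fun x => chi_flipCoord_of_notMem (Finset.notMem_erase i S) x

theorem expect_chi_mul_chi (S T : Finset (Fin n)) :
    expect (fun x => chi S x * chi T x) = if S = T then 1 else 0 := by
  simp_rw [chi_mul_chi]
  have := expect_chi (symmDiff S T)
  rw [this]
  simp [← Finset.bot_eq_empty, symmDiff_eq_bot]

/-- Parseval's identity. -/
theorem expect_sq_sum (s : Finset (Finset (Fin n))) (a : Finset (Fin n) → ℝ) :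
    expect (fun x => (∑ S ∈ s, a S * chi S x) ^ 2) = ∑ S ∈ s, a S ^ 2 := by
  have h (x : Cube n) : (∑ S ∈ s, a S * chi S x) ^ 2
      = ∑ S ∈ s, ∑ T ∈ s, (a S * a T) * (chi S x * chi T x) := by
    rw [sq, Finset.sum_mul_sum]
    refine Finset.sum_congr rfl fun S _ => Finset.sum_congr rfl fun T _ => by ring
  simp_rw [h, expect_sum, expect_const_mul, expect_chi_mul_chi]
  refine Finset.sum_congr rfl fun S hS => ?_
  simp [hS, sq]

/-- The multilinear extension of `f`, as an average against a product kernel. -/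
theorem sum_fourierCoeff_mul_prod (f : Cube n → ℝ) (z : Fin n → ℝ) :
    ∑ S, fourierCoeff f S * ∏ j ∈ S, z j
      = expect fun x => f x * ∏ j, (1 + ((x j : ℤ) : ℝ) * z j) := by
  simp_rw [Finset.prod_one_add, Finset.powerset_univ, Finset.mul_sum, expect_sum, fourierCoeff]
  refine Finset.sum_congr rfl fun S _ => ?_
  rw [mul_comm, ← expect_const_mul]
  congr 1
  ext x
  rw [Finset.prod_mul_distrib, chi]
  ring

/-- For `|z_j| ≤ 1` the product kernel is nonnegative, and the kernel identity for the constant 1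
shows that it has mean 1. The extension at `z` is therefore a weighted average of values of `f`. -/
theorem abs_multilinear_le {f : Cube n → ℝ} (hf : ∀ x, |f x| ≤ 1) {z : Fin n → ℝ}
    (hz : ∀ j, |z j| ≤ 1) : |∑ S, fourierCoeff f S * ∏ j ∈ S, z j| ≤ 1 := by
  rw [sum_fourierCoeff_mul_prod]
  have hk (x : Cube n) : 0 ≤ ∏ j, (1 + ((x j : ℤ) : ℝ) * z j) := by
    refine Finset.prod_nonneg fun j _ => ?_
    have : |((x j : ℤ) : ℝ) * z j| ≤ 1 := by rw [abs_mul, abs_sign, one_mul]; exact hz j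
    linarith [(abs_le.1 this).1]
  have h1 := sum_fourierCoeff_mul_prod (fun _ : Cube n => 1) z
  have h2 (S : Finset (Fin n)) : fourierCoeff (fun _ : Cube n => 1) S = if S = ∅ then 1 else 0 := by
    rw [← expect_chi]
    simp [fourierCoeff]
  simp only [h2, one_mul] at h1
  calc _ ≤ expect fun x => |f x * ∏ j, (1 + ((x j : ℤ) : ℝ) * z j)| := abs_expect_le _
    _ ≤ expect fun x : Cube n => ∏ j, (1 + ((x j : ℤ) : ℝ) * z j) := by
      refine expect_mono fun x => ?_
      rw [abs_mul, abs_of_nonneg (hk x)]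
      exact mul_le_of_le_one_left (hk x) (hf x)
    _ = 1 := by rw [← h1]; simp

/-- Fourier inversion. -/
theorem fourier_inversion (f : Cube n → ℝ) (x : Cube n) :
    f x = ∑ S, fourierCoeff f S * chi S x := by
  have h := sum_fourierCoeff_mul_prod f (fun j => ((x j : ℤ) : ℝ))
  -- At a vertex the kernel is a point mass: one coordinate of disagreement makes a factor vanish.
  have hk (y : Cube n) : ∏ j, (1 + ((y j : ℤ) : ℝ) * ((x j : ℤ) : ℝ))
      = if y = x then 2 ^ n else 0 := by
    split_ifs with e
    · subst e
      simp [sign_mul_self]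
      norm_num
    · obtain ⟨j, hj⟩ := Function.ne_iff.1 e
      refine Finset.prod_eq_zero (Finset.mem_univ j) ?_
      rcases Int.units_eq_one_or (y j) with h1 | h1 <;>
        rcases Int.units_eq_one_or (x j) with h2 | h2 <;> simp_all
  simp_rw [chi]
  rw [h]
  simp_rw [hk]
  simp [expect]

theorem fourierCoeff_eq_zero_of_degree_lt {f : Cube n → ℝ} {S : Finset (Fin n)}
    (h : degree f < S.card) : fourierCoeff f S = 0 := by
  classical
  by_contra h0
  refine absurd h (not_lt.2 ?_)
  unfold degree
  exact Finset.le_sup (f := Finset.card) (by simpa using h0)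

theorem abs_fourierCoeff_le {f : Cube n → ℝ} (hf : ∀ x, |f x| ≤ 1) (S : Finset (Fin n)) :
    |fourierCoeff f S| ≤ 1 := by
  refine (abs_expect_le _).trans ?_
  rw [← expect_const (Ω := Cube n) 1]
  refine expect_mono fun x => ?_
  rw [abs_mul, abs_chi, mul_one]
  exact hf x

/-- The number of sets of size at most `m`. -/
theorem card_filter_card_le (m : ℕ) :
    (Finset.univ.filter fun S : Finset (Fin n) => S.card ≤ m).card ≤ (n + 1) ^ m := by
  classical
  have h : (Finset.univ.filter fun S : Finset (Fin n) => S.card ≤ m)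
      ⊆ (Finset.range (m + 1)).biUnion fun j => Finset.powersetCard j Finset.univ := by
    intro S hS
    simp only [Finset.mem_filter, Finset.mem_univ, true_and] at hS
    simp [Finset.mem_powersetCard]
    omega
  refine (Finset.card_le_card h).trans (Finset.card_biUnion_le.trans ?_)
  -- Termwise against the binomial expansion of `(n + 1) ^ m`: `C(n, j) ≤ n^j ≤ n^j C(m, j)`.
  rw [add_pow]
  refine Finset.sum_le_sum fun j hj => ?_
  rw [Finset.card_powersetCard, Finset.card_univ, Fintype.card_fin, one_pow, mul_one]
  exact (Nat.choose_le_pow n j).trans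
    (Nat.le_mul_of_pos_right _ (Nat.choose_pos (by simpa [Nat.lt_succ_iff] using hj)))

/-! ### Hypercontractivity -/

/-- Bonami's inequality for polynomials of degree `d` in the coordinates of `T`. -/
theorem expect_pow_four_le_powerset (T : Finset (Fin n)) :
    ∀ (d : ℕ) (a : Finset (Fin n) → ℝ), (∀ S, d < S.card → a S = 0) →
      expect (fun x => (∑ S ∈ T.powerset, a S * chi S x) ^ 4)
        ≤ 9 ^ d * (expect fun x => (∑ S ∈ T.powerset, a S * chi S x) ^ 2) ^ 2 := by
  induction T using Finset.induction_on with
  | empty =>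
    intro d a _
    simp only [Finset.powerset_empty, Finset.sum_singleton, chi_empty, mul_one, expect_const]
    nlinarith [one_le_pow₀ (M₀ := ℝ) (a := 9) (n := d) (by norm_num), sq_nonneg (a ∅ ^ 2)]
  | insert i T hi ih =>
    intro d a ha
    -- Split the polynomial as `h + x_i k` with `h`, `k` independent of `x_i`. Odd powers of `x_i`
    -- average to zero, and `k` has degree one less.
    set b : Finset (Fin n) → ℝ := fun S => if i ∈ S then 0 else a (insert i S) with hb
    set h : Cube n → ℝ := fun x => ∑ S ∈ T.powerset, a S * chi S x with hh
    set k : Cube n → ℝ := fun x => ∑ S ∈ T.powerset, b S * chi S x with hk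
    have hsplit (x : Cube n) :
        ∑ S ∈ (insert i T).powerset, a S * chi S x = h x + ((x i : ℤ) : ℝ) * k x := by
      rw [Finset.sum_powerset_insert hi]
      congr 1
      rw [hk, Finset.mul_sum]
      refine Finset.sum_congr rfl fun S hS => ?_
      have hiS : i ∉ S := fun e => hi (Finset.mem_powerset.1 hS e)
      simp only [hb, hiS, if_false, chi_insert hiS]
      ring
    have hflip (c : Finset (Fin n) → ℝ) (x : Cube n) :
        ∑ S ∈ T.powerset, c S * chi S (flipCoord i x) = ∑ S ∈ T.powerset, c S * chi S x := by
      refine Finset.sum_congr rfl fun S hS => ?_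
      rw [chi_flipCoord_of_notMem fun e => hi (Finset.mem_powerset.1 hS e)]
    have hhf (x) : h (flipCoord i x) = h x := hflip a x
    have hkf (x) : k (flipCoord i x) = k x := hflip b x
    set A := expect fun x => h x ^ 2 with hA
    set B := expect fun x => k x ^ 2 with hB
    have hA0 : 0 ≤ A := expect_nonneg fun x => sq_nonneg _
    have hB0 : 0 ≤ B := expect_nonneg fun x => sq_nonneg _
    have e2 : expect (fun x => (h x + ((x i : ℤ) : ℝ) * k x) ^ 2) = A + B := by
      have e (x : Cube n) : (h x + ((x i : ℤ) : ℝ) * k x) ^ 2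
          = h x ^ 2 + k x ^ 2 + ((x i : ℤ) : ℝ) * (2 * (h x * k x)) := by
        linear_combination (k x ^ 2) * sign_mul_self (x i)
      simp_rw [e]
      rw [expect_add, expect_add, expect_sign_mul (by intro x; rw [hhf, hkf]), add_zero]
    have e4 : expect (fun x => (h x + ((x i : ℤ) : ℝ) * k x) ^ 4)
        = expect (fun x => h x ^ 4) + 6 * expect (fun x => h x ^ 2 * k x ^ 2)
          + expect (fun x => k x ^ 4) := by
      have e (x : Cube n) : (h x + ((x i : ℤ) : ℝ) * k x) ^ 4
          = h x ^ 4 + 6 * (h x ^ 2 * k x ^ 2) + k x ^ 4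
            + ((x i : ℤ) : ℝ) * (4 * h x ^ 3 * k x + 4 * h x * k x ^ 3) := by
        have s := sign_mul_self (x i)
        set u := ((x i : ℤ) : ℝ)
        linear_combination (6 * h x ^ 2 * k x ^ 2 + 4 * h x * k x ^ 3 * u
          + k x ^ 4 * (u * u + 1)) * s
      simp_rw [e]
      rw [expect_add, expect_add, expect_add, expect_const_mul,
        expect_sign_mul (by intro x; rw [hhf, hkf]), add_zero]
    have hH : expect (fun x => h x ^ 4) ≤ 9 ^ d * A ^ 2 := ih d a ha
    -- The drop in degree gains the factor 9; for `d = 0` it forces `k = 0`.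
    have hK : 9 * expect (fun x => k x ^ 4) ≤ 9 ^ d * B ^ 2 := by
      cases d with
      | zero =>
        have hb0 : b = 0 := by
          ext S
          by_cases hS : i ∈ S
          · simp [hb, hS]
          · simp [hb, hS, ha (insert i S) (by simp [Finset.card_insert_of_notMem hS])]
        have hk0 (x : Cube n) : k x = 0 := by simp [hk, hb0]
        simp [hB, hk0, expect_const]
      | succ d =>
        have := ih d b (by
          intro S hS
          by_cases hiS : i ∈ S
          · simp [hb, hiS]
          · simp only [hb, hiS, if_false]
            exact ha _ (by rw [Finset.card_insert_of_notMem hiS]; omega))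
        rw [pow_succ]
        change expect (fun x => k x ^ 4) ≤ 9 ^ d * B ^ 2 at this
        linarith
    -- Cauchy–Schwarz on the mixed term, then `hH` times `hK`. In total the fourth moment is at most
    -- `9^d (A² + 2AB + B²/9) ≤ 9^d (A + B)²`.
    have hHK : 3 * expect (fun x => h x ^ 2 * k x ^ 2) ≤ 9 ^ d * (A * B) := by
      refine abs_le_of_sq_le_sq' ?_ (by positivity) |>.2
      have cs := sq_expect_mul_le (fun x => h x ^ 2) (fun x => k x ^ 2)
      simp only [← pow_mul] at cs
      norm_num at cs
      have hK0 : 0 ≤ expect (fun x => k x ^ 4) := expect_nonneg fun x => by positivity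
      have := mul_le_mul hH hK (by positivity) (by positivity)
      calc _ = 9 * (expect (fun x => h x ^ 2 * k x ^ 2)) ^ 2 := by ring
        _ ≤ 9 ^ d * A ^ 2 * (9 ^ d * B ^ 2) := by linarith
        _ = _ := by ring
    simp_rw [hsplit]
    rw [e2, e4]
    have hB9 : 0 ≤ 9 ^ d * B ^ 2 := by positivity
    nlinarith

theorem expect_pow_four_le (d : ℕ) (a : Finset (Fin n) → ℝ) (ha : ∀ S, d < S.card → a S = 0) :
    expect (fun x => (∑ S, a S * chi S x) ^ 4)
      ≤ 9 ^ d * (expect fun x => (∑ S, a S * chi S x) ^ 2) ^ 2 := by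
  simpa using expect_pow_four_le_powerset Finset.univ d a ha

/-- The `L²` norm of a low degree polynomial is controlled by its `L¹` norm. -/
theorem expect_sq_le_sq_expect_abs (d : ℕ) (a : Finset (Fin n) → ℝ)
    (ha : ∀ S, d < S.card → a S = 0) :
    expect (fun x => (∑ S, a S * chi S x) ^ 2)
      ≤ 8 * 9 ^ d * (expect fun x => |∑ S, a S * chi S x|) ^ 2 := by
  set g : Cube n → ℝ := fun x => ∑ S, a S * chi S x with hg
  have h4 : expect (fun x => g x ^ 4) ≤ 9 ^ d * (expect fun x => g x ^ 2) ^ 2 :=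
    expect_pow_four_le d a ha
  change expect (fun x => g x ^ 2) ≤ 8 * 9 ^ d * (expect fun x => |g x|) ^ 2
  set Q := expect fun x => g x ^ 2
  set L := expect fun x => |g x|
  have hQ0 : 0 ≤ Q := expect_nonneg fun x => sq_nonneg _
  have hL0 : 0 ≤ L := expect_nonneg fun x => abs_nonneg _
  rcases hQ0.eq_or_lt with h | hQ
  · rw [← h]; positivity
  -- Pointwise `g² ≤ t|g| + g⁴/t²`, by comparing `|g|` with `t`. This `t` makes the fourth moment
  -- term at most `Q / 2`, so that it can be absorbed on the left.
  set t := √(2 * 9 ^ d * Q)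
  have ht2 : t ^ 2 = 2 * 9 ^ d * Q := Real.sq_sqrt (by positivity)
  have ht : 0 < t := Real.sqrt_pos.2 (by positivity)
  have hpt (x : Cube n) : g x ^ 2 ≤ t * |g x| + (t ^ 2)⁻¹ * g x ^ 4 := by
    rw [← sq_abs (g x), show g x ^ 4 = |g x| ^ 4 by rw [Even.pow_abs (by decide)]]
    have h0 := abs_nonneg (g x)
    rcases le_total |g x| t with h | h
    · have : 0 ≤ (t ^ 2)⁻¹ * |g x| ^ 4 := by positivity
      nlinarith
    · have h1 : |g x| ^ 2 ≤ (t ^ 2)⁻¹ * |g x| ^ 4 := by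
        rw [inv_mul_eq_div, le_div_iff₀ (by positivity)]
        have : t ^ 2 ≤ |g x| ^ 2 := by gcongr
        nlinarith [sq_nonneg |g x|]
      have : 0 ≤ t * |g x| := by positivity
      linarith
  have h1 : Q ≤ t * L + (t ^ 2)⁻¹ * expect fun x => g x ^ 4 := by
    rw [← expect_const_mul, ← expect_const_mul, ← expect_add]
    exact expect_mono hpt
  have h2 : (t ^ 2)⁻¹ * (expect fun x => g x ^ 4) ≤ Q / 2 := by
    rw [inv_mul_le_iff₀ (by positivity), ht2]
    linarith
  have h3 : Q ≤ 2 * (t * L) := by linarith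
  have h5 : Q * Q ≤ Q * (8 * 9 ^ d * L ^ 2) := by
    calc Q * Q ≤ (2 * (t * L)) * (2 * (t * L)) := by gcongr
      _ = 4 * t ^ 2 * L ^ 2 := by ring
      _ = _ := by rw [ht2]; ring
  exact le_of_mul_le_mul_left h5 hQ

end BooleanCube

namespace BooleanCube

/-! ### The linear coefficient of a bounded polynomial -/

open Polynomial in
-- Extrapolation: `2^(d+1) P(t/2) - P(t)` loses the term of degree `d + 1`, multiplies the linear
-- coefficient by `2^d - 1`, and is bounded by `(2^(d+1) + 1) M`. Since `2^(d+1) + 1 ≤ 5 (2^d - 1)`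
-- for `d ≥ 1`, each degree costs a factor 5.
theorem abs_coeff_one_le (d : ℕ) : ∀ (P : ℝ[X]) (M : ℝ), P.natDegree ≤ d →
    (∀ t ∈ Set.Icc (0 : ℝ) 1, |P.eval t| ≤ M) → |P.coeff 1| ≤ 2 * 5 ^ d * M := by
  induction d with
  | zero =>
    intro P M hP h
    have hM : 0 ≤ M := (abs_nonneg _).trans (h 0 (by simp))
    rw [coeff_eq_zero_of_natDegree_lt (by omega)]
    simp [hM]
  | succ d ih =>
    intro P M hP h
    have hM : 0 ≤ M := (abs_nonneg _).trans (h 0 (by simp))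
    -- For degree 1 the multiplier `2^d - 1` vanishes, but there the coefficient is `P(1) - P(0)`.
    rcases Nat.eq_zero_or_pos d with rfl | hd
    · have h0 := h 0 (by simp)
      have h1 := h 1 (by simp)
      rw [eval_eq_sum_range' (n := 2) (by omega)] at h0 h1
      simp only [Finset.sum_range_succ, Finset.sum_range_zero] at h0 h1
      norm_num at h0 h1
      rw [abs_le] at *
      constructor <;> norm_num <;> linarith [h0.1, h0.2, h1.1, h1.2]
    · set Q : ℝ[X] := C (2 ^ (d + 1)) * P.comp (C (1 / 2) * X) - P with hQ
      have hc (k : ℕ) : Q.coeff k = 2 ^ (d + 1) * (P.coeff k * (1 / 2) ^ k) - P.coeff k := by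
        rw [hQ, coeff_sub, coeff_C_mul, comp_C_mul_X_coeff]
      have hdeg : Q.natDegree ≤ d := by
        rw [natDegree_le_iff_coeff_eq_zero]
        intro k hk
        rw [hc]
        rcases (Nat.succ_le_of_lt hk).eq_or_lt with e | e
        · rw [← e, Nat.succ_eq_add_one, one_div, inv_pow]
          field_simp
          ring
        · rw [coeff_eq_zero_of_natDegree_lt (by omega)]
          simp
      have hb : ∀ t ∈ Set.Icc (0 : ℝ) 1, |Q.eval t| ≤ (2 ^ (d + 1) + 1) * M := by
        intro t ht
        have h1 := h t ht
        have h2 := h (1 / 2 * t) ⟨by linarith [ht.1], by linarith [ht.2]⟩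
        simp only [hQ, eval_sub, eval_mul, eval_C, eval_comp, eval_X]
        calc _ ≤ |2 ^ (d + 1) * P.eval (1 / 2 * t)| + |P.eval t| := abs_sub _ _
          _ ≤ 2 ^ (d + 1) * M + M := by
            rw [abs_mul, abs_of_pos (by positivity : (0 : ℝ) < 2 ^ (d + 1))]
            gcongr
          _ = _ := by ring
      have hi := ih Q _ hdeg hb
      have h2 : (2 : ℝ) ≤ 2 ^ d := by
        simpa using pow_le_pow_right₀ (by norm_num : (1 : ℝ) ≤ 2) hd
      have h1 : Q.coeff 1 = (2 ^ d - 1) * P.coeff 1 := by rw [hc]; ring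
      rw [h1, abs_mul, abs_of_pos (by linarith)] at hi
      have h3 : 0 ≤ 2 * 5 ^ d * M := by positivity
      have h4 : (2 ^ d - 1) * |P.coeff 1| ≤ (2 ^ d - 1) * (2 * 5 ^ (d + 1) * M) := by
        refine hi.trans ?_
        rw [pow_succ, pow_succ]
        nlinarith
      exact le_of_mul_le_mul_left h4 (by linarith)

/-! ### The sum of the absolute values of the Fourier coefficients -/

variable {n : ℕ}

/-- Reindexing along the bijection `S ↦ S ∪ {i}` from sets avoiding `i` to sets containing `i`; both
sums range over all sets, padded with zeros. -/
theorem sum_mem_eq_sum_insert (i : Fin n) (G : Finset (Fin n) → ℝ) :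
    ∑ S, (if i ∈ S then G S else 0) = ∑ S, if i ∈ S then 0 else G (insert i S) := by
  have h := Finset.sum_powerset_insert (Finset.notMem_erase i Finset.univ)
    (fun S => if i ∈ S then G S else 0)
  have h' := Finset.sum_powerset_insert (Finset.notMem_erase i Finset.univ)
    (fun S => if i ∈ S then 0 else G (insert i S))
  rw [Finset.insert_erase (Finset.mem_univ i), Finset.powerset_univ] at h h'
  have hi {S : Finset (Fin n)} (hS : S ∈ (Finset.univ.erase i).powerset) : i ∉ S :=
    fun e => Finset.notMem_erase i _ (Finset.mem_powerset.1 hS e)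
  rw [h, h', Finset.sum_eq_zero (fun S hS => by simp [hi hS]), zero_add,
    Finset.sum_eq_zero (s := (Finset.univ.erase i).powerset)
      (f := fun S => if i ∈ insert i S then 0 else G (insert i (insert i S)))
      (fun S hS => by simp), add_zero]
  exact Finset.sum_congr rfl fun S hS => by simp [hi hS]

/-- The Fourier coefficients of the derivative of `f` in direction `i`. -/
noncomputable def derivCoeff (f : Cube n → ℝ) (i : Fin n) (S : Finset (Fin n)) : ℝ :=
  if i ∈ S then 0 else fourierCoeff f (insert i S)

theorem sum_mul_chi_erase (f : Cube n → ℝ) (i : Fin n) (x : Cube n) :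
    ∑ S, (if i ∈ S then fourierCoeff f S * chi (S.erase i) x else 0)
      = ∑ S, derivCoeff f i S * chi S x := by
  rw [sum_mem_eq_sum_insert]
  refine Finset.sum_congr rfl fun S _ => ?_
  by_cases h : i ∈ S <;> simp [derivCoeff, h]

open Polynomial in
-- Evaluate the multilinear extension at `x_j (1 - u_j t)`. For `t ∈ [0, 1]` this point stays in the
-- solid cube because `0 ≤ u_j ≤ 2`, and minus the derivative at `t = 0` is the sum in question.
theorem abs_sum_mul_deriv_le {f : Cube n → ℝ} (hf : ∀ x, |f x| ≤ 1) {d : ℕ} (hd : degree f ≤ d)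
    (x : Cube n) {u : Fin n → ℝ} (hu : ∀ i, u i ∈ Set.Icc (0 : ℝ) 2) :
    |∑ i, u i * (((x i : ℤ) : ℝ) * ∑ S, derivCoeff f i S * chi S x)| ≤ 2 * 5 ^ d := by
  classical
  set q : Fin n → ℝ[X] := fun j => C ((x j : ℤ) : ℝ) * (1 - C (u j) * X) with hq
  set P : ℝ[X] := ∑ S, C (fourierCoeff f S) * ∏ j ∈ S, q j with hP
  have hqd (j) : (q j).natDegree ≤ 1 := by
    refine (natDegree_C_mul_le _ _).trans ((natDegree_sub_le _ _).trans ?_)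
    simp only [natDegree_one, zero_le, sup_of_le_right]
    exact (natDegree_C_mul_le _ _).trans natDegree_X_le
  have hdeg : P.natDegree ≤ d := by
    refine natDegree_sum_le_of_forall_le _ _ fun S _ => ?_
    by_cases hS : degree f < S.card
    · simp [fourierCoeff_eq_zero_of_degree_lt hS]
    · refine (natDegree_C_mul_le _ _).trans ((natDegree_prod_le _ _).trans ?_)
      exact (Finset.sum_le_sum fun j _ => hqd j).trans (by simp; omega)
  have heval : ∀ t ∈ Set.Icc (0 : ℝ) 1, |P.eval t| ≤ 1 := by
    intro t ht
    have := abs_multilinear_le hf (z := fun j => ((x j : ℤ) : ℝ) * (1 - u j * t)) (by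
      intro j
      rw [abs_mul, abs_sign, one_mul, abs_le]
      have h1 := mul_nonneg (hu j).1 ht.1
      have h2 := mul_le_mul (hu j).2 ht.2 ht.1 (by norm_num)
      constructor <;> linarith)
    simpa [hP, hq, eval_finsetSum, eval_prod] using this
  have hc : P.coeff 1 = - ∑ i, u i * (((x i : ℤ) : ℝ) * ∑ S, derivCoeff f i S * chi S x) := by
    have h1 : P.coeff 1 = P.derivative.eval 0 := by
      rw [← coeff_zero_eq_eval_zero, coeff_derivative, Nat.cast_zero, zero_add,
        zero_add, mul_one]
    have h2 (i) : (derivative (q i)).eval 0 = - (u i * ((x i : ℤ) : ℝ)) := by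
      simp only [hq, derivative_C_mul, derivative_sub, derivative_one, derivative_X, eval_C_mul,
        eval_neg, eval_C, mul_one, zero_sub]
      ring
    have h3 (S : Finset (Fin n)) : ∏ j ∈ S, (q j).eval 0 = chi S x := by
      simp [hq, chi]
    have h5 (S : Finset (Fin n)) : (derivative (C (fourierCoeff f S) * ∏ j ∈ S, q j)).eval 0
        = fourierCoeff f S * ∑ i ∈ S, chi (S.erase i) x * -(u i * ((x i : ℤ) : ℝ)) := by
      rw [derivative_C_mul, eval_C_mul, derivative_prod_finset, eval_finsetSum]
      congr 1
      refine Finset.sum_congr rfl fun i _ => ?_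
      rw [eval_mul, eval_prod, h2, h3]
    rw [h1, hP, derivative_sum, eval_finsetSum]
    simp_rw [h5, ← sum_mul_chi_erase]
    rw [← Finset.sum_neg_distrib]
    have h4 (S : Finset (Fin n)) :
        fourierCoeff f S * ∑ i ∈ S, chi (S.erase i) x * -(u i * ((x i : ℤ) : ℝ))
        = ∑ i, if i ∈ S then
            -(u i * (((x i : ℤ) : ℝ) * (fourierCoeff f S * chi (S.erase i) x))) else 0 := by
      rw [Finset.sum_ite_mem, Finset.univ_inter, Finset.mul_sum]
      exact Finset.sum_congr rfl fun i _ => by ring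
    simp_rw [h4]
    rw [Finset.sum_comm]
    refine Finset.sum_congr rfl fun i _ => ?_
    rw [Finset.mul_sum, Finset.mul_sum, ← Finset.sum_neg_distrib]
    exact Finset.sum_congr rfl fun S _ => by split_ifs <;> simp
  have := abs_coeff_one_le d P 1 hdeg heval
  rwa [hc, abs_neg, mul_one] at this

/-- The total influence bound for bounded functions of low degree, at every point. -/
theorem sum_abs_deriv_le {f : Cube n → ℝ} (hf : ∀ x, |f x| ≤ 1) {d : ℕ} (hd : degree f ≤ d)
    (x : Cube n) : ∑ i, |∑ S, derivCoeff f i S * chi S x| ≤ 2 * 5 ^ d := by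
  set D : Fin n → ℝ := fun i => ((x i : ℤ) : ℝ) * ∑ S, derivCoeff f i S * chi S x with hD
  -- The weights cannot be negative, so the positive and the negative terms are selected separately;
  -- the difference of the two sums is twice the sum of absolute values.
  have h1 := abs_sum_mul_deriv_le hf hd x (u := fun i => if 0 ≤ D i then 2 else 0)
    (by intro i; split_ifs <;> simp)
  have h2 := abs_sum_mul_deriv_le hf hd x (u := fun i => if 0 ≤ D i then 0 else 2)
    (by intro i; split_ifs <;> simp)
  have h3 : 2 * ∑ i, |∑ S, derivCoeff f i S * chi S x|
      = ∑ i, (if 0 ≤ D i then 2 else 0) * D i - ∑ i, (if 0 ≤ D i then 0 else 2) * D i := by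
    rw [Finset.mul_sum, ← Finset.sum_sub_distrib]
    refine Finset.sum_congr rfl fun i _ => ?_
    have : |∑ S, derivCoeff f i S * chi S x| = |D i| := by
      rw [hD, abs_mul, abs_sign, one_mul]
    rw [this]
    split_ifs with h
    · rw [abs_of_nonneg h]; ring
    · rw [abs_of_neg (not_le.1 h)]; ring
  have h4 := (abs_le.1 h1).2
  have h5 := (abs_le.1 h2).1
  change ∑ i, (if 0 ≤ D i then (2 : ℝ) else 0) * D i ≤ _ at h4
  change _ ≤ ∑ i, (if 0 ≤ D i then (0 : ℝ) else 2) * D i at h5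
  linarith

theorem derivCoeff_eq_zero {f : Cube n → ℝ} {d : ℕ} (hd : degree f ≤ d + 1) (i : Fin n)
    {S : Finset (Fin n)} (hS : d < S.card) : derivCoeff f i S = 0 := by
  unfold derivCoeff
  split_ifs with h
  · rfl
  · exact fourierCoeff_eq_zero_of_degree_lt (by rw [Finset.card_insert_of_notMem h]; omega)

/-- Cauchy–Schwarz over the at most `(n + 1) ^ d` possible sets, then Parseval and the `L²`–`L¹`
comparison. -/
theorem sum_abs_derivCoeff_le {f : Cube n → ℝ} {d : ℕ} (hd : degree f ≤ d + 1) (i : Fin n) :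
    ∑ S, |derivCoeff f i S|
      ≤ √((n + 1) ^ d * (8 * 9 ^ d)) * expect fun x => |∑ S, derivCoeff f i S * chi S x| := by
  have hL : 0 ≤ expect fun x => |∑ S, derivCoeff f i S * chi S x| :=
    expect_nonneg fun x => abs_nonneg _
  have hy := expect_sq_le_sq_expect_abs d (derivCoeff f i) fun S hS => derivCoeff_eq_zero hd i hS
  rw [expect_sq_sum] at hy
  set s := Finset.univ.filter fun S : Finset (Fin n) => S.card ≤ d
  have h1 : ∑ S, |derivCoeff f i S| = ∑ S ∈ s, |derivCoeff f i S| := by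
    refine (Finset.sum_subset (Finset.subset_univ s) fun S _ hS => ?_).symm
    rw [derivCoeff_eq_zero hd i (by simpa [s] using hS), abs_zero]
  have h2 : (∑ S ∈ s, |derivCoeff f i S|) ^ 2 ≤ s.card * ∑ S ∈ s, |derivCoeff f i S| ^ 2 :=
    sq_sum_le_card_mul_sum_sq
  have h3 : ∑ S ∈ s, |derivCoeff f i S| ^ 2 ≤ ∑ S, derivCoeff f i S ^ 2 := by
    simp_rw [sq_abs]
    exact Finset.sum_le_sum_of_subset_of_nonneg (Finset.subset_univ s) fun _ _ _ => sq_nonneg _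
  have h4 : (s.card : ℝ) ≤ (n + 1) ^ d := by exact_mod_cast card_filter_card_le d
  rw [h1]
  refine abs_le_of_sq_le_sq' ?_ (by positivity) |>.2
  rw [mul_pow, Real.sq_sqrt (by positivity)]
  calc _ ≤ _ := h2
    _ ≤ (n + 1) ^ d * (8 * 9 ^ d * (expect fun x => |∑ S, derivCoeff f i S * chi S x|) ^ 2) := by
      gcongr
      exact h3.trans hy
    _ = _ := by ring

/-- Differentiating once lowers the degree and saves a factor `√n` over direct Cauchy–Schwarz. The
sum over `i` costs no power of `n`, since it is taken inside the expectation, where the pointwise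
influence bound applies. -/
theorem sum_abs_fourierCoeff_le {f : Cube n → ℝ} (hf : ∀ x, |f x| ≤ 1) {d : ℕ}
    (hd : degree f ≤ d + 1) :
    ∑ S, |fourierCoeff f S| ≤ 1 + √((n + 1) ^ d * (8 * 9 ^ d)) * (2 * 5 ^ (d + 1)) := by
  have h1 : ∑ S, |fourierCoeff f S|
      ≤ ∑ S, ((if S = ∅ then 1 else 0) + ∑ i, if i ∈ S then |fourierCoeff f S| else 0) := by
    refine Finset.sum_le_sum fun S _ => ?_
    by_cases h : S = ∅
    · subst h
      simpa using abs_fourierCoeff_le hf ∅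
    · obtain ⟨i, hi⟩ := Finset.nonempty_iff_ne_empty.2 h
      rw [if_neg h, zero_add]
      refine le_trans ?_ (Finset.single_le_sum (fun j _ => ?_) (Finset.mem_univ i))
      · rw [if_pos hi]
      · split_ifs <;> simp
  refine h1.trans ?_
  rw [Finset.sum_add_distrib, Finset.sum_comm]
  simp_rw [sum_mem_eq_sum_insert]
  have h2 : ∑ i, ∑ S, (if i ∈ S then 0 else |fourierCoeff f (insert i S)|)
      = ∑ i, ∑ S, |derivCoeff f i S| := by
    refine Finset.sum_congr rfl fun i _ => Finset.sum_congr rfl fun S _ => ?_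
    unfold derivCoeff
    split_ifs <;> simp
  rw [h2]
  gcongr
  · simp
  · refine (Finset.sum_le_sum fun i _ => sum_abs_derivCoeff_le hd i).trans ?_
    rw [← Finset.mul_sum, ← expect_sum]
    gcongr
    rw [← expect_const (Ω := Cube n) (2 * 5 ^ (d + 1))]
    exact expect_mono fun x => sum_abs_deriv_le hf hd x

/-! ### Concentration of the empirical coefficients -/

section Concentration

variable {Ω : Type} [Fintype Ω]

/-- Markov's inequality: `F` dominates the indicator of the complement of `A`. A sum of exponentials
as `F` yields Chernoff and union bound at once. -/
theorem one_sub_expect_le_prob [Nonempty Ω] {A : Set Ω} {F : Ω → ℝ} (h0 : ∀ ω, 0 ≤ F ω)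
    (h1 : ∀ ω, ω ∉ A → 1 ≤ F ω) : 1 - expect F ≤ prob A := by
  classical
  have h : prob A = expect fun ω => if ω ∈ A then 1 else 0 := by
    unfold prob expect
    rw [Set.ncard_eq_toFinset_card']
    simp
  nth_rw 1 [h, ← expect_const (Ω := Ω) 1, ← expect_sub]
  refine expect_mono fun ω => ?_
  have := h0 ω
  split_ifs with hA
  · linarith
  · linarith [h1 ω hA]

theorem expect_prod_pi (N : ℕ) (F : Ω → ℝ) :
    expect (fun X : Fin N → Ω => ∏ j, F (X j)) = expect F ^ N := by
  unfold expect
  rw [div_pow]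
  congr 1
  · rw [← Fintype.piFinset_univ, Finset.sum_prod_piFinset Finset.univ fun _ => F]
    simp
  · simp

/-- Uses `e^u ≤ 1 + u + u²` for `|u| ≤ 1`, with `u = l Z`. -/
theorem expect_exp_le [Nonempty Ω] {Z : Ω → ℝ} (h2 : ∀ ω, |Z ω| ≤ 2) (h0 : expect Z = 0)
    (h1 : expect (fun ω => Z ω ^ 2) ≤ 1) {l : ℝ} (hl : |l| ≤ 1 / 2) :
    expect (fun ω => Real.exp (l * Z ω)) ≤ Real.exp (l ^ 2) := by
  calc _ ≤ expect fun ω => 1 + l * Z ω + l ^ 2 * Z ω ^ 2 := by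
        refine expect_mono fun ω => ?_
        have hu : |l * Z ω| ≤ 1 := by
          rw [abs_mul]
          calc |l| * |Z ω| ≤ 1 / 2 * 2 := by gcongr; exact h2 ω
            _ = 1 := by norm_num
        have := (abs_le.1 (Real.abs_exp_sub_one_sub_id_le hu)).2
        rw [mul_pow] at this
        linarith
    _ = 1 + l ^ 2 * expect fun ω => Z ω ^ 2 := by
        rw [expect_add, expect_add, expect_const, expect_const_mul, expect_const_mul, h0]
        ring
    _ ≤ 1 + l ^ 2 * 1 := by gcongr
    _ ≤ _ := by linarith [Real.add_one_le_exp (l ^ 2)]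

theorem expect_exp_sum_le [Nonempty Ω] {Z : Ω → ℝ} (h2 : ∀ ω, |Z ω| ≤ 2) (h0 : expect Z = 0)
    (h1 : expect (fun ω => Z ω ^ 2) ≤ 1) {l : ℝ} (hl : |l| ≤ 1 / 2) (N : ℕ) (b : ℝ) :
    expect (fun X : Fin N → Ω => Real.exp (l * ∑ j, Z (X j) - b))
      ≤ Real.exp (N * l ^ 2 - b) := by
  have e (X : Fin N → Ω) : Real.exp (l * ∑ j, Z (X j) - b)
      = Real.exp (- b) * ∏ j, Real.exp (l * Z (X j)) := by
    rw [← Real.exp_sum, ← Real.exp_add, Finset.mul_sum]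
    congr 1
    ring
  simp_rw [e]
  rw [expect_const_mul, expect_prod_pi N fun ω => Real.exp (l * Z ω), sub_eq_neg_add, Real.exp_add,
    Real.exp_nat_mul]
  gcongr
  · exact expect_nonneg fun _ => (Real.exp_pos _).le
  · exact expect_exp_le h2 h0 h1 hl

end Concentration

theorem empCoeff_sub_fourierCoeff {N : ℕ} (hN : 0 < N) (f : Cube n → ℝ) (X : Fin N → Cube n)
    (S : Finset (Fin n)) :
    N * (empCoeff X (fun j => f (X j)) S - fourierCoeff f S)
      = ∑ j, (f (X j) * chi S (X j) - fourierCoeff f S) := by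
  have : (N : ℝ) ≠ 0 := by positivity
  simp only [empCoeff, Finset.sum_sub_distrib, Finset.sum_const, Finset.card_univ,
    Fintype.card_fin, nsmul_eq_mul]
  field_simp

/-- With high probability all empirical coefficients of level at most `d` are `η`-accurate. -/
theorem one_sub_le_prob_empCoeff {f : Cube n → ℝ} (hf : ∀ x, |f x| ≤ 1) (d : ℕ) {N : ℕ}
    (hN : 0 < N) {η : ℝ} (hη : 0 < η) (hη1 : η ≤ 1) :
    1 - 2 * (n + 1) ^ d * Real.exp (-(N * η ^ 2 / 4))
      ≤ prob {X : Fin N → Cube n | ∀ S : Finset (Fin n), S.card ≤ d →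
          |empCoeff X (fun j => f (X j)) S - fourierCoeff f S| ≤ η} := by
  set s := Finset.univ.filter fun S : Finset (Fin n) => S.card ≤ d
  set Z : Finset (Fin n) → Cube n → ℝ := fun S x => f x * chi S x - fourierCoeff f S with hZ
  -- Chernoff with `l = ±η/2`: a deviation above `η` makes one exponent nonnegative, while the mean
  -- of each exponential is at most `exp (N η²/4 - N η²/2)`.
  set b : ℝ := N * η ^ 2 / 2 with hb
  set F : (Fin N → Cube n) → ℝ := fun X => ∑ S ∈ s,
    (Real.exp (η / 2 * ∑ j, Z S (X j) - b) + Real.exp (-(η / 2) * ∑ j, Z S (X j) - b)) with hF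
  have hN' : (0 : ℝ) < N := by exact_mod_cast hN
  have hfs (S) (x) : |f x * chi S x| ≤ 1 := by rw [abs_mul, abs_chi, mul_one]; exact hf x
  have hZ2 (S) (x) : |Z S x| ≤ 2 := by
    refine (abs_sub _ _).trans ?_
    linarith [hfs S x, abs_fourierCoeff_le hf S]
  have hZ0 (S) : expect (Z S) = 0 := by
    rw [hZ, expect_sub, expect_const]
    exact sub_self _
  have hZ1 (S) : expect (fun x => Z S x ^ 2) ≤ 1 := by
    have e (x) : Z S x ^ 2 = (f x * chi S x) ^ 2 - 2 * fourierCoeff f S * (f x * chi S x)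
        + fourierCoeff f S ^ 2 := by rw [hZ]; ring
    simp_rw [e]
    rw [expect_add, expect_sub, expect_const, expect_const_mul]
    change _ - 2 * fourierCoeff f S * fourierCoeff f S + _ ≤ _
    have : expect (fun x => (f x * chi S x) ^ 2) ≤ 1 := by
      rw [← expect_const (Ω := Cube n) 1]
      refine expect_mono fun x => ?_
      rw [sq_le_one_iff_abs_le_one]
      exact hfs S x
    nlinarith [sq_nonneg (fourierCoeff f S)]
  have hEF : expect F ≤ 2 * (n + 1) ^ d * Real.exp (-(N * η ^ 2 / 4)) := by
    have hl : |η / 2| ≤ 1 / 2 := by rw [abs_of_pos (by positivity)]; linarith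
    have hl' : |-(η / 2)| ≤ 1 / 2 := by rwa [abs_neg]
    rw [hF, expect_sum]
    calc _ ≤ ∑ S ∈ s, 2 * Real.exp (-(N * η ^ 2 / 4)) := by
          refine Finset.sum_le_sum fun S _ => ?_
          rw [expect_add]
          have h1 := expect_exp_sum_le (hZ2 S) (hZ0 S) (hZ1 S) hl N b
          have h2 := expect_exp_sum_le (hZ2 S) (hZ0 S) (hZ1 S) hl' N b
          have e1 : N * (η / 2) ^ 2 - b = -(N * η ^ 2 / 4) := by rw [hb]; ring
          have e2 : N * (-(η / 2)) ^ 2 - b = -(N * η ^ 2 / 4) := by rw [hb]; ring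
          rw [e1] at h1
          rw [e2] at h2
          linarith
      _ = s.card * (2 * Real.exp (-(N * η ^ 2 / 4))) := by simp
      _ ≤ (n + 1) ^ d * (2 * Real.exp (-(N * η ^ 2 / 4))) := by
          gcongr
          exact_mod_cast card_filter_card_le d
      _ = _ := by ring
  refine le_trans (by linarith) (one_sub_expect_le_prob (F := F) (fun X => ?_) fun X hX => ?_)
  · exact Finset.sum_nonneg fun S _ => by positivity
  · simp only [Set.mem_ofPred_eq, not_forall, not_le] at hX
    obtain ⟨S, hS, hlt⟩ := hX
    have hmem : S ∈ s := by simpa [s] using hS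
    refine le_trans ?_ (Finset.single_le_sum (fun T _ => by positivity) hmem)
    have hsum := empCoeff_sub_fourierCoeff hN f X S
    change _ = ∑ j, Z S (X j) at hsum
    rw [← hsum]
    set D := empCoeff X (fun j => f (X j)) S - fourierCoeff f S
    rcases lt_abs.1 hlt with h | h
    · have h1 : 0 ≤ η / 2 * (N * D) - b := by
        have : 0 ≤ η / 2 * N * (D - η) := mul_nonneg (by positivity) (by linarith)
        rw [hb]; linarith
      linarith [Real.one_le_exp h1, Real.exp_pos (-(η / 2) * (N * D) - b)]
    · have h1 : 0 ≤ -(η / 2) * (N * D) - b := by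
        have : 0 ≤ η / 2 * N * (-D - η) := mul_nonneg (by positivity) (by linarith)
        rw [hb]; linarith
      linarith [Real.one_le_exp h1, Real.exp_pos (η / 2 * (N * D) - b)]

/-! ### The error of the thresholded hypothesis -/

theorem sqError_largeCoeffFunction (f : Cube n → ℝ) (d : ℕ) {N : ℕ}
    (X : Fin N → Cube n) (y : Fin N → ℝ) (τ : ℝ) :
    sqError f (largeCoeffFunction d τ X y)
      = ∑ S, (fourierCoeff f S
          - if S.card ≤ d ∧ τ ≤ |empCoeff X y S| then empCoeff X y S else 0) ^ 2 := by
  classical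
  rw [← expect_sq_sum]
  unfold sqError
  congr 1
  ext x
  rw [sq_abs, fourier_inversion f x]
  congr 1
  unfold largeCoeffFunction
  rw [Finset.sum_filter, ← Finset.sum_sub_distrib]
  refine Finset.sum_congr rfl fun S _ => ?_
  rw [sub_mul, ite_mul, zero_mul]

/-- A kept coefficient has `|f̂(S)| ≥ 2η - η`, so its error `η²` is at most `η |f̂(S)|`. A dropped
one has `|f̂(S)| < 3η`, so its error `f̂(S)²` is at most `3η |f̂(S)|`. -/
theorem sqError_le_of_accurate {f : Cube n → ℝ} {d : ℕ} (hd : degree f ≤ d) {N : ℕ}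
    (X : Fin N → Cube n) (y : Fin N → ℝ) {η : ℝ}
    (h : ∀ S : Finset (Fin n), S.card ≤ d → |empCoeff X y S - fourierCoeff f S| ≤ η) :
    sqError f (largeCoeffFunction d (2 * η) X y) ≤ 3 * η * ∑ S, |fourierCoeff f S| := by
  have hη : 0 ≤ η := (abs_nonneg _).trans (h ∅ (by simp))
  rw [sqError_largeCoeffFunction, Finset.mul_sum]
  refine Finset.sum_le_sum fun S _ => ?_
  by_cases hS : S.card ≤ d
  · have h1 := h S hS
    simp only [hS, true_and]
    have h2 : |empCoeff X y S| ≤ |empCoeff X y S - fourierCoeff f S| + |fourierCoeff f S| := by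
      simpa using abs_add_le (empCoeff X y S - fourierCoeff f S) (fourierCoeff f S)
    have h3 : |fourierCoeff f S| ≤ |empCoeff X y S - fourierCoeff f S| + |empCoeff X y S| := by
      have := abs_add_le (fourierCoeff f S - empCoeff X y S) (empCoeff X y S)
      rwa [sub_add_cancel, abs_sub_comm] at this
    have h0 := abs_nonneg (fourierCoeff f S)
    split_ifs with ht
    · rw [← sq_abs, abs_sub_comm]
      have h4 := abs_nonneg (empCoeff X y S - fourierCoeff f S)
      nlinarith
    · rw [sub_zero, ← sq_abs]
      nlinarith
  · rw [fourierCoeff_eq_zero_of_degree_lt (by omega)]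
    simp [hS]

/-! ### Choice of the threshold and of the sample size -/

/-- The squared threshold is `4 ε² / sampleScale n d`. -/
noncomputable def sampleScale (n d : ℕ) : ℝ := (2 ^ 20) ^ d * (n : ℝ) ^ (d - 1)

open Classical in
/-- The threshold of the learner: a multiple of `ε`, or `2` if even the zero hypothesis is good. -/
noncomputable def threshold (n d : ℕ) (ε : ℝ) : ℝ :=
  if 1 < ε then 2 else 2 * (ε / √(sampleScale n d))

theorem sampleScale_pos {n : ℕ} (hn : 2 ≤ n) (d : ℕ) : 0 < sampleScale n d := by
  unfold sampleScale; positivity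

theorem threshold_pos {n : ℕ} (hn : 2 ≤ n) (d : ℕ) {ε : ℝ} (hε : 0 < ε) :
    0 < threshold n d ε := by
  have := sampleScale_pos hn d
  unfold threshold
  split_ifs <;> positivity

theorem three_mul_sum_abs_fourierCoeff_le (hn : 2 ≤ n) {f : Cube n → ℝ} (hf : ∀ x, |f x| ≤ 1)
    {d : ℕ} (hd1 : 1 ≤ d) (hd : degree f ≤ d) :
    3 * ∑ S, |fourierCoeff f S| ≤ √(sampleScale n d) := by
  obtain ⟨e, rfl⟩ : ∃ e, d = e + 1 := ⟨d - 1, by omega⟩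
  have h := sum_abs_fourierCoeff_le hf hd
  have hn' : (2 : ℝ) ≤ n := by exact_mod_cast hn
  -- Each of the two terms of the `ℓ¹` bound gets half of `√(sampleScale) / 3`. After squaring, the
  -- constants are `800 = 8·2²·5²` and `450 = 2·9·5²`, well below `2^20 / 36` and `2^20`.
  have hle : √(((n : ℝ) + 1) ^ e * (8 * 9 ^ e)) * (2 * 5 ^ (e + 1))
      ≤ 1 / 6 * √(sampleScale n (e + 1)) := by
    refine abs_le_of_sq_le_sq' ?_ (by positivity) |>.2
    rw [mul_pow, mul_pow (1 / 6), Real.sq_sqrt (by positivity),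
      Real.sq_sqrt (sampleScale_pos hn _).le, sampleScale, Nat.add_sub_cancel]
    have h1 : ((n : ℝ) + 1) ^ e ≤ 2 ^ e * n ^ e := by
      rw [← mul_pow]; gcongr; linarith
    calc ((n : ℝ) + 1) ^ e * (8 * 9 ^ e) * (2 * 5 ^ (e + 1)) ^ 2
        ≤ 2 ^ e * (n : ℝ) ^ e * (8 * 9 ^ e) * (2 * 5 ^ (e + 1)) ^ 2 := by gcongr
      _ = 800 * (n : ℝ) ^ e * 450 ^ e := by
        have : (450 : ℝ) ^ e = 2 ^ e * 9 ^ e * (5 ^ e) ^ 2 := by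
          rw [← mul_pow, ← pow_mul, mul_comm e, pow_mul, ← mul_pow]
          norm_num
        rw [this]
        ring
      _ ≤ 1 / 36 * 2 ^ 20 * (n : ℝ) ^ e * (2 ^ 20) ^ e := by gcongr <;> norm_num
      _ = _ := by ring
  have h1 : (1 : ℝ) ≤ 1 / 6 * √(sampleScale n (e + 1)) := by
    refine abs_le_of_sq_le_sq' ?_ (by positivity) |>.2
    rw [mul_pow, Real.sq_sqrt (sampleScale_pos hn _).le, sampleScale, Nat.add_sub_cancel]
    have h2 : (1 : ℝ) ≤ n ^ e := one_le_pow₀ (by linarith)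
    have h3 : (1 : ℝ) ≤ (2 ^ 20) ^ e := one_le_pow₀ (by norm_num)
    have h4 : (1 : ℝ) ≤ (2 ^ 20) ^ e * n ^ e := one_le_mul_of_one_le_of_one_le h3 h2
    calc (1 : ℝ) ^ 2 ≤ (1 / 6) ^ 2 * 2 ^ 20 * (1 : ℝ) := by norm_num
      _ ≤ (1 / 6) ^ 2 * 2 ^ 20 * ((2 ^ 20) ^ e * (n : ℝ) ^ e) := by gcongr
      _ = _ := by rw [pow_succ ((2 : ℝ) ^ 20)]; ring
  linarith

/-- The sample complexity bound for the thresholded hypothesis. -/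
theorem exists_sample_size (n d : ℕ) (ε δ : ℝ) (hn : 2 ≤ n) (hd : 1 ≤ d) (hε : 0 < ε)
    (hδ : 0 < δ) (hδ1 : δ < 1) :
    ∃ N₀ : ℕ, (N₀ : ℝ) ≤ (2 : ℝ) ^ ((30 : ℝ) * (d : ℝ) ^ 2) *
        ((n : ℝ) ^ (d - 1) * max (Real.log n) (Real.log (1 / δ)) / ε ^ 3) ∧
      ∀ N : ℕ, N₀ ≤ N → ∀ f : Cube n → ℝ, (∀ x, f x ∈ Set.Icc (-1 : ℝ) 1) → degree f ≤ d →
        1 - δ ≤ prob {X : Fin N → Cube n |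
          sqError f (largeCoeffFunction d (threshold n d ε) X fun j => f (X j)) ≤ ε} := by
  have hn' : (2 : ℝ) ≤ n := by exact_mod_cast hn
  have hn0 : (0 : ℝ) < n := by linarith
  set m := max (Real.log n) (Real.log (1 / δ)) with hm
  have hlog2 : 1 / 2 ≤ Real.log n := by
    have := Real.log_two_gt_d9
    have := Real.log_le_log (by norm_num) hn'
    linarith
  have hm2 : 1 / 2 ≤ m := hlog2.trans (le_max_left _ _)
  -- For `ε > 1` the threshold 2 exceeds every empirical coefficient, so the hypothesis is zero and
  -- no sample is needed.
  rcases lt_or_ge 1 ε with h1 | h1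
  · refine ⟨0, by simp only [Nat.cast_zero]; positivity, fun N _ f hf hdf => ?_⟩
    have hf' (x) : |f x| ≤ 1 := abs_le.2 (hf x)
    have := one_sub_expect_le_prob (F := fun _ : Fin N → Cube n => (0 : ℝ))
      (A := {X : Fin N → Cube n |
          sqError f (largeCoeffFunction d (threshold n d ε) X fun j => f (X j)) ≤ ε})
      (fun _ => le_rfl) (fun X hX => absurd ?_ hX)
    · rw [expect_const] at this
      linarith
    · have hemp (S : Finset (Fin n)) : |empCoeff X (fun j => f (X j)) S| ≤ 1 := by
        unfold empCoeff
        rw [abs_div, Nat.abs_cast]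
        refine div_le_one_of_le₀ ((Finset.abs_sum_le_sum_abs _ _).trans ?_) (Nat.cast_nonneg _)
        refine (Finset.sum_le_sum fun j _ => ?_).trans (b := ∑ j : Fin N, (1 : ℝ)) (by simp)
        rw [abs_mul, abs_chi, mul_one]
        exact hf' _
      have hg (x) : largeCoeffFunction d (threshold n d ε) X (fun j => f (X j)) x = 0 := by
        unfold largeCoeffFunction
        rw [Finset.filter_false_of_mem, Finset.sum_empty]
        rintro S - ⟨-, hS⟩
        rw [threshold, if_pos h1] at hS
        linarith [hemp S]
      change expect _ ≤ ε
      simp only [hg, sub_zero]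
      refine le_trans ?_ h1.le
      rw [← expect_const (Ω := Cube n) 1]
      exact expect_mono fun x => pow_le_one₀ (abs_nonneg _) (hf' x)
  · set K := sampleScale n d with hK
    have hKpos : 0 < K := sampleScale_pos hn d
    -- With `η² = ε² / K`, having `N ≥ B` means `N η² / 4 ≥ (2d + 2) m`.
    set B := 4 * ((2 * d + 2) * m) * K / ε ^ 2 with hB
    have hd' : (1 : ℝ) ≤ d := by exact_mod_cast hd
    have hp1 : (1 : ℝ) ≤ n ^ (d - 1) := one_le_pow₀ (by linarith)
    have hA1 : (2 : ℝ) ^ 20 ≤ (2 ^ 20) ^ d := by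
      calc (2 : ℝ) ^ 20 = (2 ^ 20) ^ 1 := by ring
        _ ≤ _ := by gcongr; norm_num
    have hK1 : 2 ^ 20 ≤ K := by
      rw [hK, sampleScale]
      nlinarith
    have hε2 : ε ^ 2 ≤ 1 := pow_le_one₀ hε.le h1
    have hB1 : 1 ≤ B := by
      rw [hB, le_div_iff₀ (by positivity), one_mul]
      refine hε2.trans ?_
      have : (1 : ℝ) ≤ 4 * ((2 * d + 2) * m) := by nlinarith
      nlinarith
    refine ⟨⌈B⌉₊, ?_, fun N hN f hf hdf => ?_⟩
    · have h2 : (⌈B⌉₊ : ℝ) ≤ 2 * B := by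
        have := Nat.ceil_lt_add_one (by linarith : 0 ≤ B)
        linarith
      refine h2.trans ?_
      have h3 : (2 * (4 * (2 * d + 2)) * (2 ^ 20) ^ d : ℝ) ≤ (2 : ℝ) ^ ((30 : ℝ) * (d : ℝ) ^ 2) := by
        have h4 : (d : ℝ) ≤ 2 ^ d := by exact_mod_cast d.lt_two_pow_self.le
        have h5 : (2 : ℝ) ≤ 2 ^ d := by simpa using pow_le_pow_right₀ (by norm_num : (1 : ℝ) ≤ 2) hd
        calc (2 * (4 * (2 * d + 2)) * (2 ^ 20) ^ d : ℝ)
            ≤ 2 ^ 5 * 2 ^ d * (2 ^ 20) ^ d := by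
              gcongr ?_ * _
              linarith
          _ ≤ (2 ^ d) ^ 5 * 2 ^ d * (2 ^ 20) ^ d := by gcongr
          _ = 2 ^ (26 * d) := by simp only [← pow_mul, ← pow_add]; congr 1; ring
          _ ≤ 2 ^ (30 * d ^ 2) := by
              refine pow_le_pow_right₀ (by norm_num) ?_
              nlinarith
          _ = _ := by
              rw [← Real.rpow_natCast]
              push_cast
              rfl
      have h4 : (1 : ℝ) / ε ^ 2 ≤ 1 / ε ^ 3 :=
        one_div_le_one_div_of_le (by positivity) (by nlinarith [sq_nonneg ε])
      calc 2 * B = (2 * (4 * (2 * d + 2)) * (2 ^ 20) ^ d) * (n ^ (d - 1) * m * (1 / ε ^ 2)) := by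
            rw [hB, hK, sampleScale]; ring
        _ ≤ (2 : ℝ) ^ ((30 : ℝ) * (d : ℝ) ^ 2) * (n ^ (d - 1) * m * (1 / ε ^ 3)) := by
            gcongr
        _ = _ := by ring
    · have hf' (x) : |f x| ≤ 1 := abs_le.2 (hf x)
      have hBN : B ≤ N := (Nat.le_ceil B).trans (by exact_mod_cast hN)
      have hN0 : 0 < N := by
        have : (0 : ℝ) < N := by linarith
        exact_mod_cast this
      have hs : 1 ≤ √K := Real.one_le_sqrt.2 (by linarith)
      set η := ε / √K with hη
      have hη0 : 0 < η := by positivity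
      have hη1 : η ≤ 1 := div_le_one_of_le₀ (by linarith) (by positivity)
      have hη2 : η ^ 2 = ε ^ 2 / K := by rw [hη, div_pow, Real.sq_sqrt hKpos.le]
      have hacc := one_sub_le_prob_empCoeff hf' d hN0 hη0 hη1
      -- As `n ≥ 2`, the prefactor is at most `n^(2d+1) ≤ exp ((2d + 1) m)`; the remaining `exp
      -- (-m)` is at most `δ`.
      have hexp : 2 * (n + 1) ^ d * Real.exp (-(N * η ^ 2 / 4)) ≤ δ := by
        have h2 : (2 * d + 2) * m ≤ N * η ^ 2 / 4 := by
          calc (2 * d + 2) * m = B * η ^ 2 / 4 := by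
                rw [hη2, hB]; field_simp
            _ ≤ _ := by gcongr
        have h3 : (n : ℝ) ≤ Real.exp m := by
          rw [← Real.exp_log hn0]
          exact Real.exp_le_exp.2 (le_max_left _ _)
        have h4 : Real.exp (-m) ≤ δ := by
          rw [← Real.exp_log hδ]
          refine Real.exp_le_exp.2 ?_
          have : Real.log (1 / δ) ≤ m := le_max_right _ _
          rw [one_div, Real.log_inv] at this
          linarith
        calc 2 * ((n : ℝ) + 1) ^ d * Real.exp (-(N * η ^ 2 / 4))
            ≤ n * (n ^ 2) ^ d * Real.exp (-((2 * d + 2) * m)) := by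
              gcongr
              nlinarith
          _ ≤ Real.exp m * (Real.exp m ^ 2) ^ d * Real.exp (-((2 * d + 2) * m)) := by gcongr
          _ = Real.exp (-m) := by
              rw [← Real.exp_nat_mul, ← Real.exp_nat_mul, ← Real.exp_add, ← Real.exp_add]
              congr 1
              push_cast
              ring
          _ ≤ δ := h4
      refine le_trans (by linarith) (hacc.trans ?_)
      refine div_le_div_of_nonneg_right (Nat.cast_le.2
        (Set.ncard_le_ncard (fun X hX => ?_) (Set.toFinite _))) (Nat.cast_nonneg _)
      · have := sqError_le_of_accurate hdf X (fun j => f (X j)) hX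
        rw [Set.mem_ofPred_eq, threshold, if_neg (not_lt.2 h1)]
        refine this.trans ?_
        have hL := three_mul_sum_abs_fourierCoeff_le hn hf' hd hdf
        calc 3 * η * ∑ S, |fourierCoeff f S| = η * (3 * ∑ S, |fourierCoeff f S|) := by ring
          _ ≤ η * √K := by gcongr
          _ = ε := by rw [hη]; field_simp

end BooleanCube

namespace RealRAM

/-! ### Reasoning about programs -/

theorem State.nat_setNat (s : State) (a i v b j : ℕ) :
    (s.setNat a i v).nat b j = if b = a ∧ j = i then v else s.nat b j := by
  by_cases hb : b = a
  · subst hb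
    by_cases hj : j = i <;> simp [State.setNat, hj]
  · simp [State.setNat, hb]

theorem State.real_setReal (s : State) (a i : ℕ) (v : ℝ) (b j : ℕ) :
    (s.setReal a i v).real b j = if b = a ∧ j = i then v else s.real b j := by
  by_cases hb : b = a
  · subst hb
    by_cases hj : j = i <;> simp [State.setReal, hj]
  · simp [State.setReal, hb]

theorem State.real_setNat (s : State) (a i v : ℕ) : (s.setNat a i v).real = s.real := rfl

theorem State.nat_setReal (s : State) (a i : ℕ) (v : ℝ) : (s.setReal a i v).nat = s.nat := rfl

/-- `p`, started in `s`, halts within `T` steps in a state that satisfies `Q`. -/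
def Runs (p : Prog) (s : State) (T : ℕ) (Q : State → Prop) : Prop :=
  ∃ s' t, Exec p s s' t ∧ t ≤ T ∧ Q s'

theorem Runs.mono {p : Prog} {s : State} {T T' : ℕ} {Q Q' : State → Prop} (h : Runs p s T Q)
    (hT : T ≤ T') (hQ : ∀ s', Q s' → Q' s') : Runs p s T' Q' := by
  obtain ⟨s', t, he, ht, hq⟩ := h
  exact ⟨s', t, he, ht.trans hT, hQ s' hq⟩

theorem Runs.le {p : Prog} {s : State} {T T' : ℕ} {Q : State → Prop} (h : Runs p s T Q)
    (hT : T ≤ T') : Runs p s T' Q := h.mono hT fun _ => id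

theorem Runs.seq {p q : Prog} {s : State} {T₁ T₂ : ℕ} {Q R : State → Prop}
    (h : Runs p s T₁ Q) (h' : ∀ s', Q s' → Runs q s' T₂ R) : Runs (.seq p q) s (T₁ + T₂) R := by
  obtain ⟨s', t, he, ht, hq⟩ := h
  obtain ⟨s'', t', he', ht', hr⟩ := h' s' hq
  exact ⟨s'', t + t', he.seq he', by omega, hr⟩

theorem Runs.setNat {a : ℕ} {i v : NExp} {s : State} {Q : State → Prop}
    (h : Q (s.setNat a (i.eval s) (v.eval s))) :
    Runs (.setNat a i v) s (i.cost + v.cost + 1) Q :=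
  ⟨_, _, .setNat a i v s, le_rfl, h⟩

theorem Runs.setReal {a : ℕ} {i : NExp} {v : RExp} {s : State} {Q : State → Prop}
    (h : Q (s.setReal a (i.eval s) (v.eval s))) :
    Runs (.setReal a i v) s (i.cost + v.cost + 1) Q :=
  ⟨_, _, .setReal a i v s, le_rfl, h⟩

/-- Passes on the exact new state, so straight-line code needs no intermediate assertions. -/
theorem Runs.setNat_seq {a : ℕ} {i v : NExp} {q : Prog} {s : State} {T : ℕ} {Q : State → Prop}
    (h : Runs q (s.setNat a (i.eval s) (v.eval s)) T Q) :
    Runs (.seq (.setNat a i v) q) s (i.cost + v.cost + 1 + T) Q :=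
  (Runs.setNat (Q := fun s' => s' = s.setNat a (i.eval s) (v.eval s)) rfl).seq
    fun _ hs' => hs' ▸ h

theorem Runs.setReal_seq {a : ℕ} {i : NExp} {v : RExp} {q : Prog} {s : State} {T : ℕ}
    {Q : State → Prop} (h : Runs q (s.setReal a (i.eval s) (v.eval s)) T Q) :
    Runs (.seq (.setReal a i v) q) s (i.cost + v.cost + 1 + T) Q :=
  (Runs.setReal (Q := fun s' => s' = s.setReal a (i.eval s) (v.eval s)) rfl).seq
    fun _ hs' => hs' ▸ h

theorem Runs.ite {b : Test} {p q : Prog} {s : State} {T : ℕ} {Q : State → Prop}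
    (hp : b.holds s → Runs p s T Q) (hq : ¬ b.holds s → Runs q s T Q) :
    Runs (.ite b p q) s (b.cost + T) Q := by
  by_cases hb : b.holds s
  · obtain ⟨s', t, he, ht, h⟩ := hp hb
    exact ⟨s', _, .ite_true hb he, by omega, h⟩
  · obtain ⟨s', t, he, ht, h⟩ := hq hb
    exact ⟨s', _, .ite_false hb he, by omega, h⟩

/-- A loop that makes exactly `m` rounds. -/
theorem Runs.loop {b : Test} {p : Prog} (Inv : ℕ → State → Prop) (m T : ℕ)
    (hb : ∀ j s, Inv j s → j ≤ m → (b.holds s ↔ j < m))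
    (hp : ∀ j s, Inv j s → j < m → Runs p s T (Inv (j + 1))) {s : State} (h0 : Inv 0 s) :
    Runs (.loop b p) s (m * (b.cost + T) + b.cost) (Inv m) := by
  -- Induction on the number `r` of rounds that remain.
  have key : ∀ r j s, j + r = m → Inv j s →
      Runs (.loop b p) s (r * (b.cost + T) + b.cost) (Inv m) := by
    intro r
    induction r with
    | zero =>
      intro j s hj hs
      obtain rfl : j = m := by omega
      exact ⟨s, _, .loop_done fun h => lt_irrefl _ ((hb _ s hs le_rfl).1 h), by omega, hs⟩
    | succ r ih =>
      intro j s hj hs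
      obtain ⟨s', t, he, ht, hs'⟩ := hp j s hs (by omega)
      obtain ⟨s'', t', he', ht', hs''⟩ := ih (j + 1) s' (by omega) hs'
      refine ⟨s'', _, .loop_step ((hb j s hs (by omega)).2 (by omega)) he he', ?_, hs''⟩
      rw [add_mul]
      omega
  exact key m 0 s (by omega) h0

/-- Only the listed arrays of naturals and of reals differ between `s` and `s'`. -/
def SameExcept (A B : List ℕ) (s s' : State) : Prop :=
  (∀ a, a ∉ A → s'.nat a = s.nat a) ∧ ∀ a, a ∉ B → s'.real a = s.real a

theorem SameExcept.refl (A B : List ℕ) (s : State) : SameExcept A B s s :=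
  ⟨fun _ _ => rfl, fun _ _ => rfl⟩

theorem SameExcept.trans {A B A' B' : List ℕ} {s s' s'' : State} (h : SameExcept A B s s')
    (h' : SameExcept A' B' s' s'') (hA : A ⊆ A' := by simp) (hB : B ⊆ B' := by simp) :
    SameExcept A' B' s s'' :=
  ⟨fun a ha => (h'.1 a ha).trans (h.1 a fun e => ha (hA e)),
    fun a ha => (h'.2 a ha).trans (h.2 a fun e => ha (hB e))⟩

theorem SameExcept.weaken {A B A' B' : List ℕ} {s s' : State} (h : SameExcept A B s s')
    (hA : A ⊆ A' := by simp) (hB : B ⊆ B' := by simp) : SameExcept A' B' s s' :=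
  (SameExcept.refl A B s).trans
    ⟨fun a ha => h.1 a fun e => ha (hA e), fun a ha => h.2 a fun e => ha (hB e)⟩ hA hB

theorem SameExcept.setNat {A B : List ℕ} {s s' : State} (h : SameExcept A B s s') {a : ℕ}
    (i v : ℕ) (ha : a ∈ A := by simp) : SameExcept A B s (s'.setNat a i v) := by
  refine ⟨fun b hb => ?_, h.2⟩
  rw [← h.1 b hb]
  have : b ≠ a := fun e => hb (e ▸ ha)
  simp [State.setNat, this]

theorem SameExcept.setReal {A B : List ℕ} {s s' : State} (h : SameExcept A B s s') {a : ℕ}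
    (i : ℕ) (v : ℝ) (ha : a ∈ B := by simp) : SameExcept A B s (s'.setReal a i v) := by
  refine ⟨h.1, fun b hb => ?_⟩
  rw [← h.2 b hb]
  have : b ≠ a := fun e => hb (e ▸ ha)
  simp [State.setReal, this]

/-- The natural number variable `a`. -/
abbrev NExp.var (a : ℕ) : NExp := .get a (.lit 0)

/-- The real variable `a`. -/
abbrev RExp.var (a : ℕ) : RExp := .get a (.lit 0)

/-- Increase the variable `a` by `e`. -/
abbrev Prog.incr (a : ℕ) (e : NExp) : Prog := .setNat a (.lit 0) (.add (.var a) e)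

end RealRAM

namespace BooleanCube

open RealRAM

/-! ### The learner

Variables: `nat 4` is the current coordinate, `nat 5` the current row and `nat 7` its address,
`nat 6` the number of rows before the current round, `nat 8` the address of the first free row,
`nat 9` a counter, `nat 10` the current sample and `nat 11` its address; `nat 3` holds the sizes of
the sets in the rows. `real 4` is the squared threshold, `real 5` a sum and `real 6` a product. -/

/-- Copy the current row to the first free row. -/
def copyRow : Prog :=
  .seq (.setNat 9 (.lit 0) (.lit 0)) (.loop (.lt (.var 9) (.var 0))
    (.seq (.setNat 2 (.add (.var 8) (.var 9)) (.get 2 (.add (.var 7) (.var 9))))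
      (.incr 9 (.lit 1))))

/-- Append the set in the current row, with the current coordinate added. -/
def appendRow : Prog :=
  .seq copyRow (.seq (.setNat 2 (.add (.var 8) (.var 4)) (.lit 1))
    (.seq (.setNat 3 (.var 1) (.add (.get 3 (.var 5)) (.lit 1)))
      (.seq (.incr 8 (.var 0)) (.incr 1 (.lit 1)))))

/-- Append the extension of the current row unless the row is full, and go to the next row. -/
def extendRow : Prog :=
  .seq (.ite (.lt (.get 3 (.var 5)) (.get 0 (.lit 1))) appendRow (.setNat 9 (.lit 0) (.lit 0)))
    (.seq (.incr 5 (.lit 1)) (.incr 7 (.var 0)))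

/-- Extend all rows by the current coordinate, and go to the next coordinate. -/
def extendRows : Prog :=
  .seq (.setNat 6 (.lit 0) (.var 1)) (.seq (.setNat 5 (.lit 0) (.lit 0))
    (.seq (.setNat 7 (.lit 0) (.lit 0))
      (.seq (.loop (.lt (.var 5) (.var 6)) extendRow) (.incr 4 (.lit 1)))))

/-- List all sets of size at most `d`. -/
def listSets : Prog :=
  .seq (.setNat 1 (.lit 0) (.lit 1)) (.seq (.setNat 8 (.lit 0) (.var 0))
    (.loop (.lt (.var 4) (.var 0)) extendRows))

/-- Multiply the product by the current character at the current sample. -/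
def mulChar : Prog :=
  .seq (.setNat 9 (.lit 0) (.lit 0)) (.loop (.lt (.var 9) (.var 0))
    (.seq (.ite (.lt (.lit 0) (.get 2 (.add (.var 7) (.var 9))))
        (.setReal 6 (.lit 0) (.mul (.var 6) (.get 2 (.add (.var 11) (.var 9)))))
        (.setReal 6 (.lit 0) (.var 6)))
      (.incr 9 (.lit 1))))

/-- Sum the values times the current character over all samples. -/
def sumSamples : Prog :=
  .seq (.setReal 5 (.lit 0) (.cast (.lit 0))) (.seq (.setNat 10 (.lit 0) (.lit 0))
    (.seq (.setNat 11 (.lit 0) (.lit 0)) (.loop (.lt (.var 10) (.get 0 (.lit 2)))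
      (.seq (.setReal 6 (.lit 0) (.get 1 (.var 10)))
        (.seq mulChar (.seq (.setReal 5 (.lit 0) (.add (.var 5) (.var 6)))
          (.seq (.incr 10 (.lit 1)) (.incr 11 (.var 0)))))))))

/-- Compute the coefficient of the current row, and go to the next row. -/
def rowCoeff : Prog :=
  .seq sumSamples (.seq (.setReal 5 (.lit 0) (.div (.var 5) (.cast (.get 0 (.lit 2)))))
    (.seq (.ite (.le (.var 4) (.mul (.var 5) (.var 5)))
        (.setReal 3 (.var 5) (.var 5)) (.setReal 3 (.var 5) (.cast (.lit 0))))
      (.seq (.incr 5 (.lit 1)) (.incr 7 (.var 0)))))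

/-- Compute the coefficients of all rows. -/
def allCoeffs : Prog :=
  .seq (.setNat 5 (.lit 0) (.lit 0)) (.seq (.setNat 7 (.lit 0) (.lit 0))
    (.loop (.lt (.var 5) (.var 1)) rowCoeff))

/-- Compute the squared threshold. -/
def squaredThreshold : Prog :=
  .ite (.le (.var 0) (.cast (.lit 1)))
    (.seq (.setReal 4 (.lit 0) (.mul (.mul (.cast (.lit 4)) (.mul (.var 0) (.var 0)))
        (.cast (.var 0))))
      (.loop (.lt (.var 9) (.get 0 (.lit 1)))
        (.seq (.setReal 4 (.lit 0) (.div (.var 4) (.mul (.cast (.lit 1048576)) (.cast (.var 0)))))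
          (.incr 9 (.lit 1)))))
    (.setReal 4 (.lit 0) (.cast (.lit 4)))

/-- The learner. -/
def learner : Prog := .seq squaredThreshold (.seq listSets allCoeffs)

/-! ### Listing the sets -/

/-- The source block ends before the free area, so no entry is overwritten before it is read. -/
theorem copyRow_runs {s : State} {n : ℕ} (hn : s.nat 0 0 = n)
    (hle : s.nat 7 0 + n ≤ s.nat 8 0) :
    Runs copyRow s (30 * n + 30) fun s' => SameExcept [2, 9] [] s s' ∧
      (∀ q < s.nat 8 0, s'.nat 2 q = s.nat 2 q) ∧
      ∀ q < n, s'.nat 2 (s.nat 8 0 + q) = s.nat 2 (s.nat 7 0 + q) := by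
  refine Runs.mono (Runs.setNat_seq (Runs.loop (fun j s' => SameExcept [2, 9] [] s s' ∧
      s'.nat 9 0 = j ∧ (∀ q < s.nat 8 0, s'.nat 2 q = s.nat 2 q) ∧
      ∀ q < j, s'.nat 2 (s.nat 8 0 + q) = s.nat 2 (s.nat 7 0 + q)) n 20 ?_ ?_ ?_)) ?_ ?_
  · rintro j s' ⟨hs, hj, -, -⟩ -
    simp [Test.holds, NExp.eval, hj, hs.1 0 (by simp), hn]
  · rintro j s' ⟨hs, hj, h1, h2⟩ hjn
    refine Runs.le (Runs.setNat_seq (Runs.setNat ?_)) (by simp [NExp.cost])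
    refine ⟨(hs.setNat _ _).setNat _ _, ?_, ?_, ?_⟩
    · simp [State.nat_setNat, NExp.eval, hj]
    · intro q hq
      have : q ≠ s.nat 8 0 + j := by omega
      simp [State.nat_setNat, NExp.eval, hj, hs.1 8 (by simp), this, h1 q hq]
    · intro q hq
      rcases Nat.lt_succ_iff_lt_or_eq.1 hq with h | rfl
      · have : q ≠ j := by omega
        simp [State.nat_setNat, NExp.eval, hj, hs.1 8 (by simp), this, h2 q h]
      · simp [State.nat_setNat, NExp.eval, hj, hs.1 8 (by simp), hs.1 7 (by simp)]
        exact h1 _ (by omega)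
  · refine ⟨(SameExcept.refl _ _ s).setNat _ _, ?_, ?_, ?_⟩ <;>
      simp [State.nat_setNat, NExp.eval]
  · simp [NExp.cost, Test.cost]
    omega
  · rintro s' ⟨hs, -, h⟩
    exact ⟨hs, h⟩

variable {n : ℕ}

/-- The memory holds the list `l` of sets. -/
structure Rows (s : State) (l : List (Finset (Fin n))) : Prop where
  length : s.nat 1 0 = l.length
  free : s.nat 8 0 = l.length * n
  mem_iff : ∀ k (h : k < l.length) (i : Fin n), s.nat 2 (k * n + i) ≠ 0 ↔ i ∈ l[k]
  card : ∀ k (h : k < l.length), s.nat 3 k = l[k].card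

theorem Rows.of_same {s s' : State} {l : List (Finset (Fin n))} {A B : List ℕ} (h : Rows s l)
    (hs : SameExcept A B s s') (hA : 1 ∉ A ∧ 2 ∉ A ∧ 3 ∉ A ∧ 8 ∉ A := by simp) : Rows s' l := by
  obtain ⟨h1, h2, h3, h8⟩ := hA
  constructor
  · rw [hs.1 1 h1, h.length]
  · rw [hs.1 8 h8, h.free]
  · rw [hs.1 2 h2]; exact h.mem_iff
  · rw [hs.1 3 h3]; exact h.card

theorem appendRow_runs {s : State} {l : List (Finset (Fin n))} (hl : Rows s l)
    (hn : s.nat 0 0 = n) {k : ℕ} (hk : k < l.length) (h5 : s.nat 5 0 = k) (h7 : s.nat 7 0 = k * n)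
    {i : Fin n} (h4 : s.nat 4 0 = i) (hi : i ∉ l[k]) :
    Runs appendRow s (30 * n + 80) fun s' => SameExcept [1, 2, 3, 8, 9] [] s s' ∧
      Rows s' (l ++ [insert i l[k]]) := by
  have hle : k * n + n ≤ l.length * n := by
    calc k * n + n = (k + 1) * n := by ring
      _ ≤ _ := Nat.mul_le_mul_right _ hk
  refine Runs.le (Runs.seq (copyRow_runs hn (by rw [h7, hl.free]; exact hle)) fun s' hs' =>
    Runs.setNat_seq (Runs.setNat_seq (Runs.setNat_seq (Runs.setNat ?_)))) ?_
  · obtain ⟨hs, hc1, hc2⟩ := hs'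
    rw [hl.free] at hc1 hc2
    rw [h7] at hc2
    have e0 : s'.nat 0 0 = n := by rw [hs.1 0 (by simp), hn]
    have e1 : s'.nat 1 0 = l.length := by rw [hs.1 1 (by simp), hl.length]
    have e3 : s'.nat 3 = s.nat 3 := hs.1 3 (by simp)
    have e4 : s'.nat 4 0 = i := by rw [hs.1 4 (by simp), h4]
    have e5 : s'.nat 5 0 = k := by rw [hs.1 5 (by simp), h5]
    have e8 : s'.nat 8 0 = l.length * n := by rw [hs.1 8 (by simp), hl.free]
    refine ⟨((((hs.weaken).setNat _ _).setNat _ _).setNat _ _).setNat _ _, ?_⟩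
    constructor
    · simp [State.nat_setNat, NExp.eval, e1]
    · simp [State.nat_setNat, NExp.eval, e0, e8, add_mul]
    · intro q hq j
      simp only [State.nat_setNat, NExp.eval, e4, e8]
      norm_num
      rcases lt_or_ge q l.length with h | h
      · have hlt : q * n + j < l.length * n := by
          calc q * n + j < (q + 1) * n := by rw [add_mul]; omega
            _ ≤ _ := Nat.mul_le_mul_right _ h
        rw [List.getElem_append_left h, ← hl.mem_iff q h, ← hc1 _ hlt]
        have : q * n + j ≠ l.length * n + i := by omega
        simp [this]
      · obtain rfl : q = l.length := by simp at hq; omega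
        rw [List.getElem_append_right le_rfl]
        have : l.length * n + (j : ℕ) = l.length * n + i ↔ j = i := by
          rw [Fin.ext_iff]; omega
        simp only [this, hc2 j j.2]
        have := hl.mem_iff k hk j
        simp only [Nat.sub_self, List.getElem_cons_zero, Finset.mem_insert]
        by_cases hji : j = i
        · simp [hji]
        · simpa [hji] using this
    · intro q hq
      simp only [State.nat_setNat, NExp.eval, e1, e3, e5]
      norm_num
      rcases lt_or_ge q l.length with h | h
      · rw [List.getElem_append_left h, if_neg (by omega), hl.card q h]
      · obtain rfl : q = l.length := by simp at hq; omega
        rw [List.getElem_append_right le_rfl]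
        simp [Finset.card_insert_of_notMem hi, hl.card k hk]
  · simp [NExp.cost]

theorem extendRow_runs {s : State} {l : List (Finset (Fin n))} (hl : Rows s l)
    (hn : s.nat 0 0 = n) {k : ℕ} (hk : k < l.length) (h5 : s.nat 5 0 = k) (h7 : s.nat 7 0 = k * n)
    {i : Fin n} (h4 : s.nat 4 0 = i) (hi : i ∉ l[k]) :
    Runs extendRow s (30 * n + 120) fun s' => SameExcept [1, 2, 3, 5, 7, 8, 9] [] s s' ∧
      s'.nat 5 0 = k + 1 ∧ s'.nat 7 0 = (k + 1) * n ∧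
      Rows s' (l ++ if l[k].card < s.nat 0 1 then [insert i l[k]] else []) := by
  have hite : Runs (.ite (.lt (.get 3 (.var 5)) (.get 0 (.lit 1))) appendRow
      (.setNat 9 (.lit 0) (.lit 0))) s (30 * n + 90)
      fun s' => SameExcept [1, 2, 3, 8, 9] [] s s' ∧
        Rows s' (l ++ if l[k].card < s.nat 0 1 then [insert i l[k]] else []) := by
    refine Runs.le (Runs.ite (T := 30 * n + 80) ?_ ?_) (by simp [Test.cost, NExp.cost]; omega)
    · intro h
      simp only [Test.holds, NExp.eval, h5, hl.card k hk] at h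
      rw [if_pos h]
      exact appendRow_runs hl hn hk h5 h7 h4 hi
    · intro h
      simp only [Test.holds, NExp.eval, h5, hl.card k hk] at h
      rw [if_neg h, List.append_nil]
      refine Runs.le (Runs.setNat ⟨(SameExcept.refl _ _ s).setNat _ _, ?_⟩)
        (by simp [NExp.cost])
      exact hl.of_same ((SameExcept.refl [9] [] s).setNat _ _)
  refine Runs.le (hite.seq fun s' hs' => Runs.setNat_seq (Runs.setNat ?_)) (by
    simp [NExp.cost])
  obtain ⟨hs, hr⟩ := hs'
  refine ⟨(hs.weaken.setNat _ _).setNat _ _, ?_, ?_, ?_⟩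
  · simp [State.nat_setNat, NExp.eval, hs.1 5, h5]
  · simp [State.nat_setNat, NExp.eval, hs.1 7, hs.1 0, h7, hn, add_mul]
  · exact hr.of_same (((SameExcept.refl [5, 7] [] s').setNat _ _).setNat _ _)

/-- The sets of size at most `d` below `i`, in the order in which the learner lists them. -/
def setList (n d : ℕ) : ℕ → List (Finset (Fin n))
  | 0 => [∅]
  | i + 1 => setList n d i ++ if h : i < n then
      ((setList n d i).filter fun S => S.card < d).map (insert ⟨i, h⟩) else []

/-- A set below `i + 1` either avoids `i` and is already listed, or arises from its erasure of `i`,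
which is listed and has size less than `d`. -/
theorem mem_setList (n d i : ℕ) (S : Finset (Fin n)) :
    S ∈ setList n d i ↔ S.card ≤ d ∧ ∀ j ∈ S, (j : ℕ) < i := by
  induction i generalizing S with
  | zero =>
    simp only [setList, List.mem_singleton, not_lt_zero]
    constructor
    · rintro rfl; simp
    · rintro ⟨-, h⟩; exact Finset.eq_empty_of_forall_notMem h
  | succ i ih =>
    rw [setList, List.mem_append, ih]
    constructor
    · rintro (⟨h1, h2⟩ | h)
      · exact ⟨h1, fun j hj => (h2 j hj).trans (Nat.lt_succ_self i)⟩
      · split_ifs at h with hi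
        · simp only [List.mem_map, List.mem_filter, ih, decide_eq_true_eq] at h
          obtain ⟨T, ⟨⟨-, hT⟩, hc⟩, rfl⟩ := h
          refine ⟨(Finset.card_insert_le _ _).trans hc, fun j hj => ?_⟩
          rcases Finset.mem_insert.1 hj with rfl | hj
          · exact Nat.lt_succ_self i
          · exact (hT j hj).trans (Nat.lt_succ_self i)
        · simp at h
    · rintro ⟨h1, h2⟩
      by_cases hi : ∃ h : i < n, (⟨i, h⟩ : Fin n) ∈ S
      · obtain ⟨h, hm⟩ := hi
        right
        simp only [dif_pos h, List.mem_map, List.mem_filter, ih, decide_eq_true_eq]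
        have hc := Finset.card_erase_of_mem hm
        have hpos : 0 < S.card := Finset.card_pos.2 ⟨_, hm⟩
        refine ⟨S.erase ⟨i, h⟩, ⟨⟨by omega, fun j hj => ?_⟩, by omega⟩, Finset.insert_erase hm⟩
        obtain ⟨hne, hj⟩ := Finset.mem_erase.1 hj
        have := h2 j hj
        have : (j : ℕ) ≠ i := fun e => hne (Fin.ext e)
        omega
      · left
        refine ⟨h1, fun j hj => ?_⟩
        have := h2 j hj
        have : (j : ℕ) ≠ i := by
          rintro rfl
          exact hi ⟨j.2, hj⟩
        omega

theorem notMem_of_mem_setList {d : ℕ} {i : Fin n} {S : Finset (Fin n)}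
    (h : S ∈ setList n d i) : i ∉ S :=
  fun hi => lt_irrefl _ (((mem_setList n d i S).1 h).2 i hi)

/-- Old sets avoid `i` and new ones contain it; inserting `i` is injective on sets that avoid it. -/
theorem nodup_setList (n d i : ℕ) : (setList n d i).Nodup := by
  induction i with
  | zero => simp [setList]
  | succ i ih =>
    rw [setList]
    split_ifs with hi
    · refine List.Nodup.append ih ((ih.filter _).map_on ?_) ?_
      · intro S hS T hT hST
        have hS' := notMem_of_mem_setList (i := ⟨i, hi⟩) (List.mem_filter.1 hS).1
        have hT' := notMem_of_mem_setList (i := ⟨i, hi⟩) (List.mem_filter.1 hT).1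
        rw [← Finset.erase_insert hS', hST, Finset.erase_insert hT']
      · intro S hS hS'
        obtain ⟨T, -, rfl⟩ := List.mem_map.1 hS'
        exact notMem_of_mem_setList (i := ⟨i, hi⟩) hS (Finset.mem_insert_self _ _)
    · simpa using ih

theorem toFinset_setList (n d : ℕ) :
    (setList n d n).toFinset = Finset.univ.filter fun S : Finset (Fin n) => S.card ≤ d := by
  ext S
  simp [mem_setList]

theorem length_setList_le (n d i : ℕ) : (setList n d i).length ≤ (n + 1) ^ d := by
  rw [← List.toFinset_card_of_nodup (nodup_setList n d i)]
  refine (Finset.card_le_card fun S hS => ?_).trans (card_filter_card_le (n := n) d)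
  rw [List.mem_toFinset, mem_setList] at hS
  simpa using hS.1

theorem extendRows_runs {s : State} {d : ℕ} {i : ℕ} (hi : i < n)
    (hl : Rows s (setList n d i)) (hn : s.nat 0 0 = n) (hd : s.nat 0 1 = d) (h4 : s.nat 4 0 = i) :
    Runs extendRows s ((n + 1) ^ d * (30 * n + 130) + 50) fun s' =>
      SameExcept [1, 2, 3, 4, 5, 6, 7, 8, 9] [] s s' ∧ s'.nat 4 0 = i + 1 ∧
      Rows s' (setList n d (i + 1)) := by
  set l := setList n d i with hldef
  -- The list after `k` rows have been treated. The loop bound in `nat 6` is the length before the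
  -- round, so rows appended meanwhile are not extended again.
  set ext : ℕ → List (Finset (Fin n)) := fun k =>
    l ++ ((l.take k).filter fun S => S.card < d).map (insert ⟨i, hi⟩) with hext
  refine Runs.le (Runs.setNat_seq (Runs.setNat_seq (Runs.setNat_seq (Runs.seq (Runs.loop
    (fun k s' => SameExcept [1, 2, 3, 5, 6, 7, 8, 9] [] s s' ∧ s'.nat 5 0 = k ∧
      s'.nat 6 0 = l.length ∧ s'.nat 7 0 = k * n ∧ Rows s' (ext k)) l.length (30 * n + 120)
      ?_ ?_ ?_) fun s' hs' => Runs.setNat ?_)))) ?_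
  · rintro k s' ⟨-, h5, h6, -, -⟩ -
    simp [Test.holds, NExp.eval, h5, h6]
  · rintro k s' ⟨hs, h5, h6, h7, hr⟩ hk
    have hk' : k < (ext k).length := by
      rw [hext, List.length_append]; omega
    have hget : (ext k)[k] = l[k] := List.getElem_append_left hk
    refine (extendRow_runs (i := ⟨i, hi⟩) hr (by rw [hs.1 0 (by simp), hn]) hk' h5 h7
      (by rw [hs.1 4 (by simp), h4]) ?_).mono le_rfl ?_
    · rw [hget]
      exact notMem_of_mem_setList (d := d) (List.getElem_mem hk)
    · rintro s'' ⟨hs', h5', h7', hr'⟩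
      refine ⟨hs.trans hs'.weaken, h5', by rw [hs'.1 6 (by simp), h6], h7', ?_⟩
      convert hr' using 1
      rw [hget, hs.1 0 (by simp), hd, hext]
      simp only [List.take_add_one, List.getElem?_eq_getElem hk, Option.toList_some,
        List.filter_append, List.map_append, List.append_assoc]
      congr 2
      split_ifs with h <;> simp [h]
  · refine ⟨(((SameExcept.refl _ _ s).setNat _ _).setNat _ _).setNat _ _, ?_, ?_, ?_, ?_⟩
    · simp [State.nat_setNat, NExp.eval]
    · simp [State.nat_setNat, NExp.eval, hl.length]
    · simp [State.nat_setNat, NExp.eval]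
    · have : ext 0 = l := by simp [hext]
      rw [this]
      exact hl.of_same ((((SameExcept.refl [5, 6, 7] [] s).setNat _ _).setNat _ _).setNat _ _)
  · obtain ⟨hs, -, -, -, hr⟩ := hs'
    refine ⟨hs.weaken.setNat _ _, ?_, ?_⟩
    · simp [State.nat_setNat, NExp.eval, hs.1 4, h4]
    · have : ext l.length = setList n d (i + 1) := by
        simp only [hext, List.take_length, setList, dif_pos hi, hldef]
      rw [← this]
      exact hr.of_same ((SameExcept.refl [4] [] s').setNat _ _)
  · have hlen : l.length ≤ (n + 1) ^ d := length_setList_le n d i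
    have := Nat.mul_le_mul_right (30 * n + 130) hlen
    have h2 : l.length * (5 + (30 * n + 120)) ≤ l.length * (30 * n + 130) :=
      Nat.mul_le_mul_left _ (by omega)
    simp only [NExp.cost, Test.cost]
    norm_num
    omega

theorem listSets_runs {s : State} {d : ℕ} (hn : s.nat 0 0 = n) (hd : s.nat 0 1 = d)
    (h4 : s.nat 4 0 = 0) (h2 : s.nat 2 = 0) (h3 : s.nat 3 = 0) :
    Runs listSets s (n * ((n + 1) ^ d * (30 * n + 130) + 60) + 20) fun s' =>
      SameExcept [1, 2, 3, 4, 5, 6, 7, 8, 9] [] s s' ∧ Rows s' (setList n d n) := by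
  refine Runs.mono (Runs.setNat_seq (Runs.setNat_seq (Runs.loop
    (fun i s' => SameExcept [1, 2, 3, 4, 5, 6, 7, 8, 9] [] s s' ∧ s'.nat 4 0 = i ∧
      Rows s' (setList n d i)) n ((n + 1) ^ d * (30 * n + 130) + 50) ?_ ?_ ?_))) ?_ ?_
  · rintro i s' ⟨hs, h4', -⟩ -
    simp [Test.holds, NExp.eval, h4', hs.1 0, hn]
  · rintro i s' ⟨hs, h4', hr⟩ hi
    refine (extendRows_runs hi hr (by rw [hs.1 0 (by simp), hn]) (by rw [hs.1 0 (by simp), hd])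
      h4').mono le_rfl ?_
    rintro s'' ⟨hs', h⟩
    exact ⟨hs.trans hs', h⟩
  · refine ⟨((SameExcept.refl _ _ s).setNat _ _).setNat _ _, ?_, ?_⟩
    · simp [State.nat_setNat, NExp.eval, h4]
    -- Row 0 of the zeroed arrays already encodes the empty set and its size.
    · constructor <;> simp [State.nat_setNat, NExp.eval, setList, h2, h3, hn]
  · have : n * (5 + ((n + 1) ^ d * (30 * n + 130) + 50))
        ≤ n * ((n + 1) ^ d * (30 * n + 130) + 60) := Nat.mul_le_mul_left _ (by omega)
    simp only [NExp.cost, Test.cost]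
    norm_num
    omega
  · rintro s' ⟨hs, -, hr⟩
    exact ⟨hs, hr⟩

end BooleanCube

namespace BooleanCube

open RealRAM

variable {n : ℕ}

/-! ### Computing the coefficients -/

/-- Entry `q` of the row at address `b`, as a factor: the coordinate `q` of the sample at address
`b'` if the row contains `q`. -/
noncomputable def rowFactor (s : State) (b b' q : ℕ) : ℝ :=
  if 0 < s.nat 2 (b + q) then s.real 2 (b' + q) else 1

theorem rowFactor_of_same {s s' : State} {A B : List ℕ} (hs : SameExcept A B s s')
    (hA : 2 ∉ A := by simp) (hB : 2 ∉ B := by simp) : rowFactor s' = rowFactor s := by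
  funext b b' q
  rw [rowFactor, rowFactor, hs.1 2 hA, hs.2 2 hB]

theorem mulChar_runs {s : State} (hn : s.nat 0 0 = n) :
    Runs mulChar s (40 * n + 30) fun s' => SameExcept [9] [6] s s' ∧
      s'.real 6 0 = s.real 6 0 *
        ∏ q ∈ Finset.range n, rowFactor s (s.nat 7 0) (s.nat 11 0) q := by
  refine Runs.mono (Runs.setNat_seq (Runs.loop (fun j s' => SameExcept [9] [6] s s' ∧
      s'.nat 9 0 = j ∧ s'.real 6 0 = s.real 6 0 *
        ∏ q ∈ Finset.range j, rowFactor s (s.nat 7 0) (s.nat 11 0) q) n 35 ?_ ?_ ?_)) ?_ ?_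
  · rintro j s' ⟨hs, hj, -⟩ -
    simp [Test.holds, NExp.eval, hj, hs.1 0 (by simp), hn]
  · rintro j s' ⟨hs, hj, h6⟩ hjn
    refine Runs.le (Runs.seq (T₁ := 27) (Q := fun s'' => SameExcept [9] [6] s s'' ∧
      s''.nat 9 0 = j ∧ s''.real 6 0 = s.real 6 0 *
        ∏ q ∈ Finset.range (j + 1), rowFactor s (s.nat 7 0) (s.nat 11 0) q) ?_
      fun s'' hs'' => Runs.setNat ?_) (by simp [NExp.cost])
    · refine Runs.le (Runs.ite (T := 17) (fun h => ?_) fun h => ?_)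
        (by simp [NExp.cost, Test.cost])
      · refine Runs.le (Runs.setReal ⟨hs.setReal _ _, hj, ?_⟩) (by simp [NExp.cost, RExp.cost])
        simp only [Test.holds, NExp.eval, hj, hs.1 7 (by simp), hs.1 2 (by simp)] at h
        rw [Finset.prod_range_succ, ← mul_assoc, ← h6, rowFactor, if_pos h]
        simp [State.real_setReal, NExp.eval, RExp.eval, hj, hs.1 11, hs.2 2]
      · refine Runs.le (Runs.setReal ⟨hs.setReal _ _, hj, ?_⟩) (by simp [NExp.cost, RExp.cost])
        simp only [Test.holds, NExp.eval, hj, hs.1 7 (by simp), hs.1 2 (by simp)] at h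
        rw [Finset.prod_range_succ, ← mul_assoc, ← h6, rowFactor, if_neg h]
        simp [State.real_setReal, NExp.eval, RExp.eval]
    · obtain ⟨hs', hj', h6'⟩ := hs''
      exact ⟨hs'.setNat _ _, by simp [State.nat_setNat, NExp.eval, hj'], h6'⟩
  · refine ⟨(SameExcept.refl _ _ s).setNat _ _, ?_, ?_⟩
    · simp [State.nat_setNat, NExp.eval]
    · simp [State.real_setNat]
  · simp [NExp.cost, Test.cost]
    omega
  · rintro s' ⟨hs, -, h⟩
    exact ⟨hs, h⟩

/-- The sum computed by `sumSamples` for the row at address `b`. -/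
noncomputable def sampleSum (s : State) (n N b : ℕ) : ℝ :=
  ∑ j ∈ Finset.range N, s.real 1 j * ∏ q ∈ Finset.range n, rowFactor s b (j * n) q

theorem sampleSum_of_same {s s' : State} {A B : List ℕ} (hs : SameExcept A B s s')
    (hA : 2 ∉ A := by simp) (hB : 1 ∉ B ∧ 2 ∉ B := by simp) : sampleSum s' = sampleSum s := by
  funext n N b
  rw [sampleSum, sampleSum, rowFactor_of_same hs hA hB.2, hs.2 1 hB.1]

/-- The running product starts at `y_j` instead of 1, so `mulChar` leaves the complete summand in
`real 6`. -/
theorem sumSamples_runs {s : State} {N : ℕ} (hn : s.nat 0 0 = n) (hN : s.nat 0 2 = N) :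
    Runs sumSamples s (N * (40 * n + 70) + 30) fun s' => SameExcept [9, 10, 11] [5, 6] s s' ∧
      s'.real 5 0 = sampleSum s n N (s.nat 7 0) := by
  refine Runs.mono (Runs.setReal_seq (Runs.setNat_seq (Runs.setNat_seq (Runs.loop (fun j s' =>
      SameExcept [9, 10, 11] [5, 6] s s' ∧ s'.nat 10 0 = j ∧ s'.nat 11 0 = j * n ∧
      s'.real 5 0 = sampleSum s n j (s.nat 7 0)) N (40 * n + 65) ?_ ?_ ?_)))) ?_ ?_
  · rintro j s' ⟨hs, hj, -, -⟩ -
    simp [Test.holds, NExp.eval, hj, hs.1 0 (by simp), hN]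
  · rintro j s' ⟨hs, hj, h11, h5⟩ hjN
    have hs1 := hs.setReal (a := 6) 0 (s'.real 1 j)
    refine Runs.le (Runs.setReal_seq (Runs.seq (mulChar_runs (n := n) ?_) fun s'' hs'' =>
      Runs.setReal_seq (Runs.setNat_seq (Runs.setNat ?_)))) ?_
    · simp only [State.nat_setReal]
      rw [hs.1 0 (by simp), hn]
    · obtain ⟨hs2, h6⟩ := hs''
      simp only [NExp.eval, RExp.eval, hj] at hs2 h6
      have hs3 := hs1.trans (A' := [9, 10, 11]) (B' := [5, 6]) hs2.weaken
      have e10 : s''.nat 10 0 = j := by rw [hs2.1 10 (by simp)]; exact hj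
      have e11 : s''.nat 11 0 = j * n := by rw [hs2.1 11 (by simp)]; exact h11
      have e5 : s''.real 5 0 = sampleSum s n j (s.nat 7 0) := by
        rw [hs2.2 5 (by simp)]; exact h5
      have e0 : s''.nat 0 0 = n := by rw [hs3.1 0 (by simp), hn]
      refine ⟨((hs3.setReal _ _).setNat _ _).setNat _ _, ?_, ?_, ?_⟩
      · simp [State.nat_setNat, State.nat_setReal, NExp.eval, e10]
      · simp [State.nat_setNat, State.nat_setReal, NExp.eval, e11, e0, add_mul]
      · rw [sampleSum, Finset.sum_range_succ, ← sampleSum]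
        rw [rowFactor_of_same hs1] at h6
        simp only [State.nat_setReal, h11, State.real_setReal] at h6
        simp [State.real_setNat, State.real_setReal, NExp.eval, RExp.eval, e5, h6, hs.1 7, hs.2 1]
    · simp [NExp.cost, RExp.cost]
      omega
  · refine ⟨(((SameExcept.refl _ _ s).setReal _ _).setNat _ _).setNat _ _, ?_, ?_, ?_⟩
    · simp [State.nat_setNat, NExp.eval]
    · simp [State.nat_setNat, NExp.eval]
    · simp [State.real_setNat, State.real_setReal, NExp.eval, RExp.eval, sampleSum]
  · have : N * (5 + (40 * n + 65)) = N * (40 * n + 70) := by ring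
    simp [NExp.cost, RExp.cost, Test.cost]
    omega
  · rintro s' ⟨hs, -, -, h⟩
    exact ⟨hs, h⟩

open Classical in
/-- The coefficient that the learner assigns to row `k`. -/
noncomputable def rowValue (s : State) (n N k : ℕ) : ℝ :=
  if s.real 4 0 ≤ sampleSum s n N (k * n) / N * (sampleSum s n N (k * n) / N) then
    sampleSum s n N (k * n) / N else 0

theorem rowValue_of_same {s s' : State} {A B : List ℕ} (hs : SameExcept A B s s')
    (hA : 2 ∉ A := by simp) (hB : 1 ∉ B ∧ 2 ∉ B ∧ 4 ∉ B := by simp) :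
    rowValue s' = rowValue s := by
  funext n N k
  rw [rowValue, rowValue, sampleSum_of_same hs hA ⟨hB.1, hB.2.1⟩, hs.2 4 hB.2.2]

theorem rowCoeff_runs {s : State} {N k : ℕ} (hn : s.nat 0 0 = n) (hN : s.nat 0 2 = N)
    (h5 : s.nat 5 0 = k) (h7 : s.nat 7 0 = k * n) :
    Runs rowCoeff s (N * (40 * n + 70) + 90) fun s' =>
      SameExcept [5, 7, 9, 10, 11] [3, 5, 6] s s' ∧ s'.nat 5 0 = k + 1 ∧
      s'.nat 7 0 = (k + 1) * n ∧ (∀ q, q ≠ k → s'.real 3 q = s.real 3 q) ∧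
      s'.real 3 k = rowValue s n N k := by
  refine Runs.le (Runs.seq (sumSamples_runs hn hN) fun s1 hs1 => Runs.setReal_seq
    (Runs.seq (T₁ := 20) (Q := fun s2 => SameExcept [9, 10, 11] [3, 5, 6] s s2 ∧
      (∀ q, q ≠ k → s2.real 3 q = s.real 3 q) ∧ s2.real 3 k = rowValue s n N k) ?_
      fun s2 hs2 => Runs.setNat_seq (Runs.setNat ?_))) ?_
  · obtain ⟨hs, hv⟩ := hs1
    rw [h7] at hv
    have e5 : s1.nat 5 0 = k := by rw [hs.1 5 (by simp), h5]
    have e4 : s1.real 4 0 = s.real 4 0 := by rw [hs.2 4 (by simp)]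
    have e2 : s1.nat 0 2 = N := by rw [hs.1 0 (by simp), hN]
    refine Runs.le (Runs.ite (T := 8) (fun h => ?_) fun h => ?_)
      (by simp [NExp.cost, RExp.cost, Test.cost])
    · refine Runs.le (Runs.setReal ⟨(hs.weaken.setReal _ _).setReal _ _, ?_, ?_⟩)
        (by simp [NExp.cost, RExp.cost])
      · intro q hq
        simp [State.real_setReal, State.nat_setReal, NExp.eval, e5, hq, hs.2 3]
      · simp [Test.holds, State.real_setReal, RExp.eval, NExp.eval, hv, e2, e4] at h
        rw [rowValue, if_pos h]
        simp [State.real_setReal, State.nat_setReal, NExp.eval, RExp.eval, e5, hv, e2]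
    · refine Runs.le (Runs.setReal ⟨(hs.weaken.setReal _ _).setReal _ _, ?_, ?_⟩)
        (by simp [NExp.cost, RExp.cost])
      · intro q hq
        simp [State.real_setReal, State.nat_setReal, NExp.eval, e5, hq, hs.2 3]
      · simp [Test.holds, State.real_setReal, RExp.eval, NExp.eval, hv, e2, e4] at h
        rw [rowValue, if_neg (not_le.2 h)]
        simp [State.real_setReal, State.nat_setReal, NExp.eval, RExp.eval, e5]
  · obtain ⟨hs, h3, hk⟩ := hs2
    refine ⟨(hs.weaken.setNat _ _).setNat _ _, ?_, ?_, h3, hk⟩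
    · simp [State.nat_setNat, NExp.eval, hs.1 5, h5]
    · simp [State.nat_setNat, NExp.eval, hs.1 7, hs.1 0, hn, h7, add_mul]
  · simp [NExp.cost, RExp.cost]

theorem allCoeffs_runs {s : State} {N K : ℕ} (hn : s.nat 0 0 = n) (hN : s.nat 0 2 = N)
    (hK : s.nat 1 0 = K) :
    Runs allCoeffs s (K * (N * (40 * n + 70) + 100) + 20) fun s' =>
      SameExcept [5, 7, 9, 10, 11] [3, 5, 6] s s' ∧ ∀ q < K, s'.real 3 q = rowValue s n N q := by
  refine Runs.mono (Runs.setNat_seq (Runs.setNat_seq (Runs.loop (fun k s' =>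
      SameExcept [5, 7, 9, 10, 11] [3, 5, 6] s s' ∧ s'.nat 5 0 = k ∧ s'.nat 7 0 = k * n ∧
      ∀ q < k, s'.real 3 q = rowValue s n N q) K (N * (40 * n + 70) + 90) ?_ ?_ ?_))) ?_ ?_
  · rintro k s' ⟨hs, h5, -, -⟩ -
    simp [Test.holds, NExp.eval, h5, hs.1 1, hK]
  · rintro k s' ⟨hs, h5, h7, h3⟩ -
    refine (rowCoeff_runs (n := n) (N := N) (by rw [hs.1 0 (by simp), hn])
      (by rw [hs.1 0 (by simp), hN]) h5 h7).mono le_rfl ?_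
    rintro s'' ⟨hs', h5', h7', hq, hk⟩
    refine ⟨hs.trans hs', h5', h7', fun q hqk => ?_⟩
    rw [rowValue_of_same hs] at hk
    rcases Nat.lt_succ_iff_lt_or_eq.1 hqk with h | rfl
    · rw [hq q h.ne, h3 q h]
    · exact hk
  · refine ⟨((SameExcept.refl _ _ s).setNat _ _).setNat _ _, ?_, ?_, ?_⟩ <;>
      simp [State.nat_setNat, NExp.eval]
  · have : K * (5 + (N * (40 * n + 70) + 90)) ≤ K * (N * (40 * n + 70) + 100) :=
      Nat.mul_le_mul_left _ (by omega)
    simp only [NExp.cost, Test.cost]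
    norm_num
    omega
  · rintro s' ⟨hs, -, -, h⟩
    exact ⟨hs, h⟩

/-! ### The squared threshold -/

/-- The form that the machine computes, by `d` divisions by `2^20 n`; the extra `n` in the numerator
turns `n^d` into `n^(d-1)`. -/
theorem threshold_sq (hn : 2 ≤ n) {d : ℕ} (hd : 1 ≤ d) (ε : ℝ) :
    threshold n d ε ^ 2
      = if 1 < ε then 4 else 4 * (ε * ε) * n / (1048576 * n) ^ d := by
  unfold threshold
  split_ifs with h
  · norm_num
  · have hn0 : (n : ℝ) ≠ 0 := by positivity
    obtain ⟨e, rfl⟩ : ∃ e, d = e + 1 := ⟨d - 1, by omega⟩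
    rw [mul_pow, div_pow, Real.sq_sqrt (sampleScale_pos hn _).le, sampleScale, Nat.add_sub_cancel,
      mul_pow, pow_succ (n : ℝ)]
    norm_num
    field_simp

theorem squaredThreshold_runs (hn : 2 ≤ n) {d : ℕ} (hd : 1 ≤ d) {ε : ℝ} {s : State}
    (h0 : s.nat 0 0 = n) (h1 : s.nat 0 1 = d) (h9 : s.nat 9 0 = 0) (hε : s.real 0 0 = ε) :
    Runs squaredThreshold s (40 * d + 40) fun s' => SameExcept [9] [4] s s' ∧
      s'.real 4 0 = threshold n d ε ^ 2 := by
  rw [threshold_sq hn hd]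
  refine Runs.le (Runs.ite (T := 40 * d + 30) (fun h => ?_) fun h => ?_)
    (by simp [NExp.cost, RExp.cost, Test.cost]; omega)
  · simp [Test.holds, RExp.eval, NExp.eval, hε] at h
    rw [if_neg (not_lt.2 h)]
    -- The counter `nat 9` is not reset by the program: it is zero in the input.
    refine Runs.mono (Runs.setReal_seq (Runs.loop (fun j s' => SameExcept [9] [4] s s' ∧
      s'.nat 9 0 = j ∧ s'.real 4 0 = 4 * (ε * ε) * n / (1048576 * n) ^ j) d 30 ?_ ?_ ?_)) ?_ ?_
    · rintro j s' ⟨hs, hj, -⟩ -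
      simp [Test.holds, NExp.eval, hj, hs.1 0, h1]
    · rintro j s' ⟨hs, hj, h4⟩ -
      refine Runs.le (Runs.setReal_seq (Runs.setNat ?_)) (by simp [NExp.cost, RExp.cost])
      refine ⟨(hs.setReal _ _).setNat _ _, ?_, ?_⟩
      · simp [State.nat_setNat, State.nat_setReal, NExp.eval, hj]
      · simp [State.real_setNat, State.real_setReal, NExp.eval, RExp.eval, h4, hs.1 0, h0]
        rw [pow_succ, div_div]
    · refine ⟨(SameExcept.refl _ _ s).setReal _ _, ?_, ?_⟩
      · simp [State.nat_setReal, h9]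
      · simp [State.real_setReal, NExp.eval, RExp.eval, hε, h0]
    · simp [NExp.cost, RExp.cost, Test.cost]
      omega
    · rintro s' ⟨hs, -, h⟩
      exact ⟨hs, h⟩
  · simp [Test.holds, RExp.eval, NExp.eval, hε] at h
    rw [if_pos h]
    refine Runs.le (Runs.setReal ⟨(SameExcept.refl _ _ s).setReal _ _, ?_⟩)
      (by simp [NExp.cost, RExp.cost])
    simp [State.real_setReal, NExp.eval, RExp.eval]

/-! ### The learner is correct and runs in polynomial time -/

theorem rowFactor_eq {s : State} {l : List (Finset (Fin n))} (hl : Rows s l) {k : ℕ}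
    (hk : k < l.length) (b' : ℕ) (i : Fin n) :
    rowFactor s (k * n) b' i = if i ∈ l[k] then s.real 2 (b' + i) else 1 := by
  rw [rowFactor]
  simp only [Nat.pos_iff_ne_zero, hl.mem_iff k hk i]

/-- Decodes the row-major layout of the samples by quotient and remainder. For `N = 0` both sides
are zero by the convention on division. -/
theorem sampleSum_div_eq_empCoeff {s : State} {l : List (Finset (Fin n))} (hl : Rows s l) {k : ℕ}
    (hk : k < l.length) {N d : ℕ} {ε : ℝ} {X : Fin N → Cube n} {y : Fin N → ℝ}
    (h1 : s.real 1 = (learnerInput d ε X y).real 1) (h2 : s.real 2 = (learnerInput d ε X y).real 2) :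
    sampleSum s n N (k * n) / N = empCoeff X y l[k] := by
  rw [sampleSum, empCoeff, Finset.sum_range]
  congr 1
  refine Finset.sum_congr rfl fun j _ => ?_
  rw [Finset.prod_range]
  simp only [rowFactor_eq hl hk, h1, h2, Finset.prod_ite_mem, Finset.univ_inter, chi]
  congr 1
  · simp [learnerInput]
  · refine Finset.prod_congr rfl fun i _ => ?_
    have hn : 0 < n := i.pos
    have hdiv : ((j : ℕ) * n + i) / n = j := by
      rw [mul_comm, Nat.mul_add_div hn, Nat.div_eq_of_lt i.2, add_zero]
    have hmod : ((j : ℕ) * n + i) % n = i := by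
      rw [mul_comm, Nat.mul_add_mod, Nat.mod_eq_of_lt i.2]
    simp [learnerInput, hdiv, hmod]

theorem outputFunction_eq {s : State} {l : List (Finset (Fin n))} (hl : Rows s l)
    {c : Finset (Fin n) → ℝ} (hc : ∀ k (h : k < l.length), s.real 3 k = c l[k])
    (hnd : l.Nodup) (x : Cube n) :
    outputFunction n s x = ∑ S ∈ l.toFinset, c S * chi S x := by
  rw [outputFunction, outputLength, hl.length, Finset.sum_range, List.sum_toFinset _ hnd,
    ← Fin.sum_univ_fun_getElem]
  refine Finset.sum_congr rfl fun k _ => ?_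
  rw [hc k k.2]
  congr 2
  ext i
  simp [hl.mem_iff k k.2 i]

/-- With `a = n^d` and `b = N + 1`, the inequality `n + 1 ≤ n²` gives `(n+1)^d ≤ a²`. Each part of
the time is then a multiple of `a⁴ b`, the constants add up to at most `1024 ≤ a^10`, and `4 + 10`
is the exponent. -/
theorem learner_time_le {n d : ℕ} (hn : 2 ≤ n) (hd : 1 ≤ d) (N : ℕ) {K : ℕ}
    (hK : K ≤ (n + 1) ^ d) :
    40 * d + 40 + (n * ((n + 1) ^ d * (30 * n + 130) + 60) + 20
      + (K * (N * (40 * n + 70) + 100) + 20)) ≤ (n ^ d * (N + 1)) ^ 14 := by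
  set a := n ^ d with ha
  set b := N + 1 with hb
  have ha2 : 2 ≤ a := by
    calc 2 ≤ n := hn
      _ = n ^ 1 := (pow_one n).symm
      _ ≤ a := Nat.pow_le_pow_right (by omega) hd
  have hna : n ≤ a := by
    calc n = n ^ 1 := (pow_one n).symm
      _ ≤ a := Nat.pow_le_pow_right (by omega) hd
  have hda : d ≤ a := by
    calc d ≤ 2 ^ d := d.lt_two_pow_self.le
      _ ≤ a := Nat.pow_le_pow_left hn d
  have hM : (n + 1) ^ d ≤ a ^ 2 := by
    calc (n + 1) ^ d ≤ (n ^ 2) ^ d := Nat.pow_le_pow_left (by nlinarith) d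
      _ = a ^ 2 := by rw [ha, ← pow_mul, ← pow_mul, mul_comm]
  have hb1 : 1 ≤ b := by omega
  have hNb : N ≤ b := by omega
  have h1 : 40 * d + 40 ≤ 80 * (a ^ 4 * b) := by
    have h : a ≤ a ^ 4 * b := by
      calc a = a ^ 1 * 1 := by ring
        _ ≤ a ^ 4 * b := Nat.mul_le_mul (Nat.pow_le_pow_right (by omega) (by omega)) hb1
    omega
  have h2 : n * ((n + 1) ^ d * (30 * n + 130) + 60) + 20 ≤ 240 * (a ^ 4 * b) := by
    calc n * ((n + 1) ^ d * (30 * n + 130) + 60) + 20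
        ≤ a * (a ^ 2 * (30 * a + 130 * a) + 60 * a ^ 3) + 20 * a ^ 4 := by
          have : 1 ≤ a := by omega
          have h3 : 1 ≤ a ^ 3 := Nat.one_le_pow _ _ this
          have h4 : 1 ≤ a ^ 4 := Nat.one_le_pow _ _ this
          gcongr <;> omega
      _ = 240 * (a ^ 4 * 1) := by ring
      _ ≤ _ := by gcongr
  have h3 : K * (N * (40 * n + 70) + 100) + 20 ≤ 230 * (a ^ 4 * b) := by
    calc K * (N * (40 * n + 70) + 100) + 20
        ≤ a ^ 2 * (b * (40 * a + 70 * a) + 100 * (b * a)) + 20 * (a ^ 3 * b) := by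
          have h1 : 1 ≤ a := by omega
          have h3 : 1 ≤ a ^ 3 * b := Nat.mul_pos (Nat.pow_pos h1) hb1
          have h4 : 1 ≤ b * a := Nat.mul_pos hb1 h1
          gcongr
          · exact hK.trans hM
          · omega
          · omega
          · omega
      _ = 230 * (a ^ 3 * b) := by ring
      _ ≤ _ := by gcongr <;> omega
  have h4 : 1024 ≤ a ^ 10 := by
    calc 1024 = 2 ^ 10 := by norm_num
      _ ≤ a ^ 10 := Nat.pow_le_pow_left ha2 10
  calc _ ≤ 1024 * (a ^ 4 * b) := by omega
    _ ≤ a ^ 10 * (a ^ 4 * b) := Nat.mul_le_mul_right _ h4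
    _ = a ^ 14 * b ^ 1 := by ring
    _ ≤ a ^ 14 * b ^ 14 := Nat.mul_le_mul_left _ (Nat.pow_le_pow_right hb1 (by omega))
    _ = _ := (mul_pow a b 14).symm

theorem learner_outputs {d : ℕ} (hn : 2 ≤ n) (hd : 1 ≤ d) {ε : ℝ} (hε : 0 < ε) {N : ℕ}
    (X : Fin N → Cube n) (y : Fin N → ℝ) :
    LearnerOutputs learner d ε X y ((n ^ d * (N + 1)) ^ 14)
      (largeCoeffFunction d (threshold n d ε) X y) := by
  classical
  set s := learnerInput d ε X y with hs
  have hlen := length_setList_le n d n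
  have hrun : Runs learner s (40 * d + 40 + (n * ((n + 1) ^ d * (30 * n + 130) + 60) + 20
      + ((setList n d n).length * (N * (40 * n + 70) + 100) + 20))) fun s' => Rows s' (setList n d n) ∧
      ∀ k (h : k < (setList n d n).length), s'.real 3 k =
        if threshold n d ε ≤ |empCoeff X y (setList n d n)[k]| then
          empCoeff X y (setList n d n)[k] else 0 := by
    refine Runs.seq (squaredThreshold_runs (s := s) (n := n) (ε := ε) hn hd rfl rfl rfl rfl) ?_
    rintro s1 ⟨h1, ht⟩
    refine Runs.seq (listSets_runs (n := n) (d := d) (by rw [h1.1 0 (by simp)]; rfl)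
      (by rw [h1.1 0 (by simp)]; rfl) (by rw [h1.1 4 (by simp)]; rfl)
      (by rw [h1.1 2 (by simp)]; rfl) (by rw [h1.1 3 (by simp)]; rfl)) ?_
    rintro s2 ⟨h2, hr⟩
    have h02 := h1.trans (A' := [1, 2, 3, 4, 5, 6, 7, 8, 9]) (B' := [4]) h2.weaken
    refine (allCoeffs_runs (n := n) (N := N) (by rw [h02.1 0 (by simp)]; rfl)
      (by rw [h02.1 0 (by simp)]; rfl) hr.length).mono le_rfl ?_
    rintro s3 ⟨h3, hc⟩
    refine ⟨hr.of_same h3, fun k hk => ?_⟩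
    rw [hc k hk, rowValue, h2.2 4 (by simp), ht,
      sampleSum_div_eq_empCoeff hr hk (h02.2 1 (by simp)) (h02.2 2 (by simp)), ← sq]
    -- Comparing squares is comparing absolute values, because the threshold is positive.
    congr 1
    rw [sq_le_sq, abs_of_pos (threshold_pos hn d hε)]
  obtain ⟨s', t, he, ht, hr, hc⟩ := hrun
  have htime := learner_time_le hn hd N hlen
  refine ⟨s', t, he, ht.trans htime, ?_, ?_⟩
  · rw [outputLength, hr.length]
    refine le_trans ?_ htime
    have := Nat.le_mul_of_pos_right (setList n d n).length
      (by omega : 0 < N * (40 * n + 70) + 100)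
    omega
  · funext x
    -- The memory lists every set of size at most `d`, with coefficient zero for the discarded ones;
    -- the function is the same.
    rw [outputFunction_eq hr (c := fun S =>
      if threshold n d ε ≤ |empCoeff X y S| then empCoeff X y S else 0) hc (nodup_setList n d n), toFinset_setList, largeCoeffFunction,
      ← Finset.filter_filter, 
      Finset.sum_filter (p := fun S => threshold n d ε ≤ |empCoeff X y S|)]
    refine Finset.sum_congr rfl fun S _ => ?_
    rw [ite_mul, zero_mul]

end BooleanCube

/-! ### The learner and the sample bound combined -/

theorem theorem6 :
    ∃ c : ℝ, 1 < c ∧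
    ∃ (P : RealRAM.Prog) (k : ℕ) (τ : ℕ → ℕ → ℝ → ℝ),
      -- the learner halts in time polynomial in `n ^ d` and in the number of samples, and outputs
      -- the estimated Fourier coefficients that are large
      (∀ (n d : ℕ) (ε : ℝ), 2 ≤ n → 1 ≤ d → 0 < ε → 0 < τ n d ε ∧
        ∀ (N : ℕ) (X : Fin N → BooleanCube.Cube n) (y : Fin N → ℝ),
          BooleanCube.LearnerOutputs P d ε X y ((n ^ d * (N + 1)) ^ k)
            (BooleanCube.largeCoeffFunction d (τ n d ε) X y)) ∧
      -- few samples suffice for squared error `ε`, except with probability `δ`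
      (∀ (n d : ℕ) (ε δ : ℝ), 2 ≤ n → 1 ≤ d → 0 < ε → 0 < δ → δ < 1 →
        ∃ N₀ : ℕ,
          (N₀ : ℝ) ≤ (2 : ℝ) ^ (c * (d : ℝ) ^ 2) *
            ((n : ℝ) ^ (d - 1) * max (Real.log n) (Real.log (1 / δ)) / ε ^ 3) ∧
          ∀ N : ℕ, N₀ ≤ N →
            ∀ f : BooleanCube.Cube n → ℝ, (∀ x, f x ∈ Set.Icc (-1 : ℝ) 1) →
              BooleanCube.degree f ≤ d →
              1 - δ ≤ BooleanCube.prob {X : Fin N → BooleanCube.Cube n |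
                BooleanCube.sqError f
                  (BooleanCube.largeCoeffFunction d (τ n d ε) X (fun j => f (X j))) ≤ ε}) :=
  ⟨30, by norm_num, BooleanCube.learner, 14, BooleanCube.threshold,
    fun _ d _ hn hd hε => ⟨BooleanCube.threshold_pos hn d hε,
      fun _ X y => BooleanCube.learner_outputs hn hd hε X y⟩,
    BooleanCube.exists_sample_size⟩
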